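/- Let $G$ be a finite simple undirected graph with $n$ vertices. An ordering $\sigma$ of $V(G)$ is an \emph{MCS ordering} (maximum cardinality search) if each vertex, at the moment it is visited, has the maximum number of already visited neighbors among all unvisited vertices. Given an ordering $\sigma$, an \emph{MCS$^+$ ordering with respect to $\sigma$} is an MCS ordering in which, at each step, among the unvisited vertices with the maximum number of visited neighbors, the one with the largest position in $\sigma$ is visited. A vertex $z$ is an \emph{MCS end vertex} of $G$ if some MCS ordering of $G$ ends with $z$. The graph $G$ is \emph{chordal} if it has no induced cycle on four or more vertices. \textbf{Theorem.} (a) On chordal graphs the MCS end vertex problem can be solved in $O(n^2)$ time: there is a program for the unit-cost word RAM (addition, truncated subtraction, indirect load and store, conditional jump; any word length $w$ with $2^w \ge K(n+1)^2$ for a constant $K$) that, given the adjacency matrix of a chordal graph $G$ with $n\ge 1$ vertices and a vertex $z$ of $G$, halts within $O(n^2)$ steps having computed an MCS ordering $\sigma$ of $G$ that starts with $z$ and an MCS$^+$ ordering $\tau$ of $G$ with respect to $\sigma$, and answers ``yes'' if and only if $\tau$ ends with $z$; the answer is ``yes'' if and only if $z$ is an MCS end vertex of $G$. (b) For every chordal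 graph $G$, every vertex $z$ of $G$, every MCS ordering $\sigma$ of $G$ that starts with $z$, and the MCS$^+$ ordering $\tau$ of $G$ with respect to $\sigma$: $z$ is an MCS end vertex of $G$ if and only if $z$ is the last vertex of $\tau$. -/

import Mathlib

/-! ### Chordal graphs and maximum cardinality search -/

/-- A graph is chordal if it has no induced cycle on four or more vertices. -/
def IsChordal {V : Type*} (G : SimpleGraph V) : Prop :=
  ∀ k : ℕ, 4 ≤ k → IsEmpty (SimpleGraph.cycleGraph k ↪g G)

/-- The number of neighbors of `v` that the ordering `σ` visits before it visits `u`.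
An ordering of an `n`-vertex graph is a bijection `σ : V ≃ Fin n`; positions are counted from `0`. -/
noncomputable def visitedNeighbors {V : Type*} {n : ℕ} (G : SimpleGraph V) (σ : V ≃ Fin n)
    (u v : V) : ℕ :=
  {x : V | G.Adj v x ∧ σ x < σ u}.ncard

/-- `σ` is an ordering produced by maximum cardinality search: at the moment when `u` is visited,
no unvisited vertex `v` has more visited neighbors than `u`. -/
def IsMCSOrdering {V : Type*} {n : ℕ} (G : SimpleGraph V) (σ : V ≃ Fin n) : Prop :=
  ∀ u v : V, σ u ≤ σ v → visitedNeighbors G σ u v ≤ visitedNeighbors G σ u u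

/-- `τ` is an ordering produced by maximum cardinality search with ties broken in favor of the
largest position in `σ`: at the moment when `u` is visited, `u` has the maximum number of visited
neighbors among the unvisited vertices, and `σ u` is largest among those attaining it. -/
def IsMCSPlusOrdering {V : Type*} {n : ℕ} (G : SimpleGraph V) (σ τ : V ≃ Fin n) : Prop :=
  IsMCSOrdering G τ ∧
    ∀ u v : V, τ u ≤ τ v → visitedNeighbors G τ u v = visitedNeighbors G τ u u → σ v ≤ σ u

/-- `z` is the first vertex of the ordering `σ`. -/
def IsStartVertex {V : Type*} {n : ℕ} (σ : V ≃ Fin n) (z : V) : Prop := (σ z : ℕ) = 0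

/-- `z` is the last vertex of the ordering `σ`. -/
def IsEndVertex {V : Type*} {n : ℕ} (σ : V ≃ Fin n) (z : V) : Prop := (σ z : ℕ) + 1 = n

/-- `z` is the end vertex of some maximum cardinality search of `G`. -/
def IsMCSEndVertex {V : Type*} (G : SimpleGraph V) (z : V) : Prop :=
  ∃ (n : ℕ) (σ : V ≃ Fin n), IsMCSOrdering G σ ∧ IsEndVertex σ z

/-! ### Word random access machines with unit cost -/

/-- Instructions of the machine. It has registers and a memory, both indexed by `ℕ`; a program
mentions only finitely many registers, and memory is addressed indirectly through registers. -/
inductive RAMInstr where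
  /-- `reg r := k` -/
  | const (r k : ℕ)
  /-- `reg r := reg a + reg b` -/
  | add (r a b : ℕ)
  /-- `reg r := max (reg a - reg b) 0` -/
  | sub (r a b : ℕ)
  /-- `reg r := mem (reg a)` -/
  | load (r a : ℕ)
  /-- `mem (reg a) := reg r` -/
  | store (a r : ℕ)
  /-- continue with instruction number `l` if `reg r = 0` -/
  | jumpIfZero (r l : ℕ)

/-- A program is a finite list of instructions, numbered from `0`. -/
abbrev RAMProgram := List RAMInstr

/-- A configuration: program counter, registers, memory. -/
structure RAMState where
  pc : ℕ
  reg : ℕ → ℕ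
  mem : ℕ → ℕ

/-- The effect of one instruction on a machine with words of `w` bits: computed values are
reduced modulo `2 ^ w`. -/
def RAMInstr.exec (w : ℕ) : RAMInstr → RAMState → RAMState
  | .const r k, s => ⟨s.pc + 1, Function.update s.reg r (k % 2 ^ w), s.mem⟩
  | .add r a b, s => ⟨s.pc + 1, Function.update s.reg r ((s.reg a + s.reg b) % 2 ^ w), s.mem⟩
  | .sub r a b, s => ⟨s.pc + 1, Function.update s.reg r (s.reg a - s.reg b), s.mem⟩
  | .load r a, s => ⟨s.pc + 1, Function.update s.reg r (s.mem (s.reg a)), s.mem⟩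
  | .store a r, s => ⟨s.pc + 1, s.reg, Function.update s.mem (s.reg a) (s.reg r)⟩
  | .jumpIfZero r l, s => ⟨if s.reg r = 0 then l else s.pc + 1, s.reg, s.mem⟩

/-- One step of the program. The machine has halted once the program counter leaves the program;
from then on the configuration does not change. -/
def RAMProgram.step (P : RAMProgram) (w : ℕ) (s : RAMState) : RAMState :=
  match P[s.pc]? with
  | some i => i.exec w s
  | none => s

/-- With words of `w` bits, the program started in `s` halts after at most `T` steps (each
instruction costs one step), in a configuration that satisfies `post`. -/
def RAMProgram.HaltsWithin (P : RAMProgram) (w T : ℕ) (s : RAMState) (post : RAMState → Prop) :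
    Prop :=
  ∃ t ≤ T, P.length ≤ ((P.step w)^[t] s).pc ∧ post ((P.step w)^[t] s)

open Classical in
/-- The initial configuration on the input `(G, z)`, where `G` has vertices `0, …, n - 1`:
registers `0` and `1` hold `n` and `z`, memory cells `0, …, n ^ 2 - 1` hold the adjacency matrix
of `G` row by row, and everything else is `0`. -/
noncomputable def graphInput {n : ℕ} (G : SimpleGraph (Fin n)) (z : Fin n) : RAMState where
  pc := 0
  reg := fun r => if r = 0 then n else if r = 1 then (z : ℕ) else 0
  mem := fun a => if ∃ i j : Fin n, G.Adj i j ∧ a = i * n + j then 1 else 0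

/-- The ordering `σ` is written in memory from address `a` on: cell `a + i` holds the `i`-th
visited vertex. -/
def StoredAt {n : ℕ} (s : RAMState) (a : ℕ) (σ : Fin n ≃ Fin n) : Prop :=
  ∀ i : Fin n, s.mem (a + i) = σ.symm i

/-!
Part one: the searches. In a maximum cardinality search `π` of a chordal graph, the earlier neighbors
of each vertex form a clique (`IsMCSOrdering.isClique_earlierNeighbors`), and a connected set of
unvisited vertices contains a vertex that sees its whole visited boundary
(`IsMCSOrdering.exists_complete`). Behind this, the search runs Prim's algorithm on the maximal
cliques, weighted by the sizes of their intersections. Hence it is hierarchical: once it enters a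
cluster of cliques joined by intersections of more than `t` vertices through a clique of `t` vertices,
it finishes the cluster before it leaves.

If `π` ends with `z`, the clusters around `z` are final segments of `π`, namely the tails of `π` from
those breaks after which all breaks have larger labels (`IsRecord`). A search `σ` that starts with `z`
visits each such tail before everything not attached to it (`IsRecord.lt_of_start`). Let `τ` break
ties by the largest position in `σ`. By induction along the records, `τ` enters each of these tails
only after everything outside it has been visited: since `π` can avoid the smaller tail until
the rest of the larger one is exhausted, so can `τ`, because as long as something is left, some
vertex outside the smaller tail and its attaching clique has the maximum label
(`exists_competitor`), and it wins the tie because `σ` visits it later. The last tail forms a clique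
with its attaching clique, so its vertices are always tied and `z`, the first vertex of `σ`,
comes last (`IsMCSPlusOrdering.isEndVertex`).

Part two: the machine. Structured programs (`RAMCode`) are compiled to the word RAM, with rules that
bound the number of steps (`RAMCode.Ensures`). The search program keeps for each vertex the number
`searchLabel`, scans the tie-breaking order for the last vertex of largest label, and updates the
labels along one column of the adjacency matrix, in `O(n)` steps per visited vertex. An ordering
with a given tie-breaking order exists (`exists_isMCSPlusOrdering`), and `MCSProgram.search_ensures`
shows that the program writes it down. The program runs this search twice: with ties broken by
an order that ends with `z`, which gives `σ`, and with ties broken by `σ`, which gives `τ`. No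
sum exceeds `n ^ 2 + 4 n + 2`, so words never overflow.
-/

/-! ### Earlier neighbors in a maximum cardinality search of a chordal graph -/

section MCS

variable {V : Type*} {n : ℕ} {G : SimpleGraph V} {σ : V ≃ Fin n}

/-- The neighbors of `v` that the ordering `σ` visits before `v`; the number of these vertices is
`visitedNeighbors G σ v v`, the label with which `v` is visited. -/
def earlierNeighbors (G : SimpleGraph V) (σ : V ≃ Fin n) (v : V) : Set V :=
  {x | G.Adj v x ∧ σ x < σ v}

theorem finite_of_ordering (σ : V ≃ Fin n) : Finite V := Finite.of_equiv _ σ.symm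

theorem ncard_earlierNeighbors (v : V) :
    (earlierNeighbors G σ v).ncard = visitedNeighbors G σ v v := rfl

theorem ncard_mono (σ : V ≃ Fin n) {s t : Set V} (h : s ⊆ t) : s.ncard ≤ t.ncard :=
  have := finite_of_ordering σ
  Set.ncard_le_ncard h (Set.toFinite t)

theorem eq_of_subset_of_ncard_le' (σ : V ≃ Fin n) {s t : Set V} (h : s ⊆ t)
    (h' : t.ncard ≤ s.ncard) : s = t :=
  have := finite_of_ordering σ
  Set.eq_of_subset_of_ncard_le h h' (Set.toFinite t)

theorem exists_first (σ : V ≃ Fin n) {X : Set V} (hX : X.Nonempty) :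
    ∃ c ∈ X, ∀ v ∈ X, σ c ≤ σ v :=
  have := finite_of_ordering σ
  Set.exists_min_image X σ (Set.toFinite X) hX

theorem exists_last (σ : V ≃ Fin n) {X : Set V} (hX : X.Nonempty) :
    ∃ c ∈ X, ∀ v ∈ X, σ v ≤ σ c :=
  have := finite_of_ordering σ
  Set.exists_max_image X σ (Set.toFinite X) hX

/-- If a vertex `c` that is visited after `b` sees a vertex `a` that `b` misses, then `b` sees
something that `c` misses: otherwise `c` had the larger label when `b` was visited. -/
theorem IsMCSOrdering.exchange (hσ : IsMCSOrdering G σ) {a b c : V} (hab : σ a < σ b)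
    (hbc : σ b < σ c) (hca : G.Adj c a) (hba : ¬ G.Adj b a) :
    ∃ d, σ d < σ b ∧ G.Adj b d ∧ ¬ G.Adj c d := by
  by_contra! hcon
  have := finite_of_ordering σ
  have hss : {x : V | G.Adj b x ∧ σ x < σ b} ⊂ {x : V | G.Adj c x ∧ σ x < σ b} := by
    refine ⟨fun x hx => ⟨hcon x hx.2 hx.1, hx.2⟩, fun h => hba (h ⟨hca, hab⟩).1⟩
  exact absurd (hσ b c hbc.le) (not_le.2 (Set.ncard_lt_ncard hss (Set.toFinite _)))

/-- A chordless path on at least three vertices and a vertex that is adjacent exactly to its two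
ends form an induced cycle, so a chordal graph has no such configuration. -/
theorem IsChordal.not_path_closed (hG : IsChordal G) (p : ℕ → V) (d : V) (k : ℕ) (hk : 2 ≤ k)
    (hinj : ∀ i j, i < j → j ≤ k → p i ≠ p j)
    (hadj : ∀ i j, i < j → j ≤ k → (G.Adj (p i) (p j) ↔ i + 1 = j))
    (hne : ∀ i ≤ k, p i ≠ d) (hd : ∀ i ≤ k, (G.Adj (p i) d ↔ i = 0 ∨ i = k)) : False := by
  have key : ∀ i j : Fin (k + 2), (i : ℕ) < j →
      ((SimpleGraph.cycleGraph (k + 2)).Adj i j ↔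
        ((i : ℕ) + 1 = j ∨ ((i : ℕ) = 0 ∧ (j : ℕ) = k + 1))) := by
    intro i j hij
    rw [SimpleGraph.cycleGraph_adj', Fin.val_sub, Fin.val_sub]
    have hi := i.2
    have hj := j.2
    have h1 : (k + 2 - (j : ℕ) + i) % (k + 2) = k + 2 - j + i := Nat.mod_eq_of_lt (by omega)
    have h2 : (k + 2 - (i : ℕ) + j) % (k + 2) = j - i := by
      rw [show k + 2 - (i : ℕ) + j = (j - i) + (k + 2) by omega, Nat.add_mod_right]
      exact Nat.mod_eq_of_lt (by omega)
    rw [h1, h2]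
    omega
  let f : Fin (k + 2) → V := fun i => if (i : ℕ) ≤ k then p i else d
  have hf : ∀ i j : Fin (k + 2), (i : ℕ) < j → f i ≠ f j ∧
      (G.Adj (f i) (f j) ↔ (SimpleGraph.cycleGraph (k + 2)).Adj i j) := by
    intro i j hij
    have hi : (i : ℕ) ≤ k := by have := j.2; omega
    rw [key i j hij]
    by_cases hj : (j : ℕ) ≤ k
    · simp only [f, hi, hj, if_true]
      refine ⟨hinj _ _ hij hj, ?_⟩
      rw [hadj _ _ hij hj]
      omega
    · simp only [f, hi, hj, if_true, if_false]
      refine ⟨hne _ hi, ?_⟩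
      rw [hd _ hi]
      have := j.2
      omega
  refine (hG (k + 2) (by omega)).false ⟨⟨f, ?_⟩, ?_⟩
  · intro i j hij
    rcases lt_trichotomy (i : ℕ) j with h | h | h
    · exact absurd hij (hf i j h).1
    · exact Fin.ext h
    · exact absurd hij.symm (hf j i h).1
  · intro i j
    change G.Adj (f i) (f j) ↔ _
    rcases lt_trichotomy (i : ℕ) j with h | h | h
    · exact (hf i j h).2
    · obtain rfl := Fin.ext h
      simp
    · rw [G.adj_comm, (hf j i h).2, SimpleGraph.adj_comm]

/-- The case of `IsMCSOrdering.adj_of_path` in which the path ends at the later of its two ends.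
In a counterexample whose later end is as early as possible, and which is then shortest, the path is
chordless. By `IsMCSOrdering.exchange` its later end sees a still earlier vertex `d` that the second
vertex of the path misses. Either `d` closes an induced cycle, or it gives a counterexample whose
two ends both precede the old later end. -/
theorem IsMCSOrdering.adj_of_path_aux (hG : IsChordal G) (hσ : IsMCSOrdering G σ) :
    ∀ (m k : ℕ) (p : ℕ → V), (σ (p k) : ℕ) = m → σ (p 0) < σ (p k) →
      (∀ i < k, G.Adj (p i) (p (i + 1))) → (∀ i, 0 < i → i < k → σ (p k) < σ (p i)) →
      G.Adj (p 0) (p k) := by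
  intro m
  induction m using Nat.strong_induction_on with
  | _ m ihm =>
  intro k
  induction k using Nat.strong_induction_on with
  | _ k ihk =>
  intro p hm h0k hstep hint
  -- Leaving out a piece of the path gives a shorter path between the same ends.
  have shortcut : ∀ i g, 0 < g → i + g ≤ k → (i + g = k → p i = p k → False) →
      ((i + g < k ∧ G.Adj (p i) (p (i + g + 1))) ∨ (i + g = k ∧ p i = p k)) →
      G.Adj (p 0) (p k) := by
    intro i g hg hik hne hor
    rcases hor with ⟨hlt, hadj⟩ | ⟨h1, h2⟩
    · let q : ℕ → V := fun l => if l ≤ i then p l else p (l + g)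
      have hq0 : q 0 = p 0 := by simp [q]
      have hqk : q (k - g) = p k := by
        have : ¬ (k - g ≤ i) := by omega
        simp only [q, this, if_false]
        congr 1
        omega
      have := ihk (k - g) (by omega) q (by rw [hqk, hm]) (by rw [hq0, hqk]; exact h0k) ?_ ?_
      · rwa [hq0, hqk] at this
      · intro l hl
        rcases lt_trichotomy l i with h | h | h
        · have h1 : l ≤ i := h.le
          have h2 : l + 1 ≤ i := h
          simp only [q, h1, h2, if_true]
          exact hstep l (by omega)
        · subst h
          have h2 : ¬ (l + 1 ≤ l) := by omega
          simp only [q, le_refl, h2, if_true, if_false]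
          rwa [show l + 1 + g = l + g + 1 by omega]
        · have h1 : ¬ l ≤ i := by omega
          have h2 : ¬ l + 1 ≤ i := by omega
          simp only [q, h1, h2, if_false]
          rw [show l + 1 + g = l + g + 1 by omega]
          exact hstep _ (by omega)
      · intro l hl0 hl
        rw [hqk]
        by_cases h1 : l ≤ i
        · simp only [q, h1, if_true]
          exact hint l hl0 (by omega)
        · simp only [q, h1, if_false]
          exact hint _ (by omega) (by omega)
    · exact (hne h1 h2).elim
  by_contra hxy
  have hk0 : k ≠ 0 := by
    rintro rfl
    exact lt_irrefl _ h0k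
  have hk1 : k ≠ 1 := by
    rintro rfl
    exact hxy (hstep 0 (by omega))
  have hchord : ∀ i j, i + 2 ≤ j → j ≤ k → ¬ G.Adj (p i) (p j) := by
    intro i j hij hj hadj
    refine hxy (shortcut i (j - i - 1) (by omega) (by omega) (by omega) (Or.inl ⟨by omega, ?_⟩))
    rwa [show i + (j - i - 1) + 1 = j by omega]
  have hinj : ∀ i j, i < j → j ≤ k → p i ≠ p j := by
    intro i j hij hj heq
    rcases hj.lt_or_eq with hj | rfl
    · refine hxy (shortcut i (j - i) (by omega) (by omega) (by omega) (Or.inl ⟨by omega, ?_⟩))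
      rw [show i + (j - i) + 1 = j + 1 by omega, heq]
      exact hstep j hj
    · rcases Nat.eq_zero_or_pos i with rfl | hi
      · rw [heq] at h0k
        exact lt_irrefl _ h0k
      · have := hint i hi hij
        rw [heq] at this
        exact lt_irrefl _ this
  have hadj : ∀ i j, i < j → j ≤ k → (G.Adj (p i) (p j) ↔ i + 1 = j) := by
    intro i j hij hj
    constructor
    · intro h
      by_contra hne
      exact hchord i j (by omega) hj h
    · rintro rfl
      exact hstep i (by omega)
  obtain ⟨d, hdk, hkd, hd1⟩ := hσ.exchange h0k (hint 1 (by omega) (by omega))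
    (hstep 0 (by omega)).symm (fun h => hxy h.symm)
  classical
  have hex : ∃ j, 1 ≤ j ∧ G.Adj (p j) d := ⟨k, by omega, hkd⟩
  obtain ⟨hj1, hjd⟩ := Nat.find_spec hex
  have hjmin : ∀ i, 1 ≤ i → i < Nat.find hex → ¬ G.Adj (p i) d := fun i h1 h2 h =>
    Nat.find_min hex h2 ⟨h1, h⟩
  have hjk : Nat.find hex ≤ k := Nat.find_min' hex ⟨by omega, hkd⟩
  generalize Nat.find hex = j at hj1 hjd hjmin hjk
  have hj2 : 2 ≤ j := by
    by_contra h
    obtain rfl : j = 1 := by omega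
    exact hd1 hjd
  have hlater : ∀ i, 1 ≤ i → i ≤ k → σ (p k) ≤ σ (p i) := by
    intro i h1 h2
    rcases h2.lt_or_eq with h | rfl
    · exact (hint i h1 h).le
    · exact le_rfl
  have hd0 : p 0 ≠ d := by
    rintro rfl
    exact hxy hkd.symm
  by_cases hxd : G.Adj (p 0) d
  · refine hG.not_path_closed p d j hj2 (fun i l h1 h2 => hinj i l h1 (h2.trans hjk))
      (fun i l h1 h2 => hadj i l h1 (h2.trans hjk)) ?_ ?_
    · intro i hi
      rcases Nat.eq_zero_or_pos i with rfl | h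
      · exact hd0
      · rintro rfl
        exact absurd (hlater i h (hi.trans hjk)) (not_le.2 hdk)
    · intro i hi
      constructor
      · intro h
        by_contra hne
        exact hjmin i (by omega) (by omega) h
      · rintro (rfl | rfl)
        exacts [hxd, hjd]
  · rcases lt_trichotomy (σ (p 0)) (σ d) with h | h | h
    · let q : ℕ → V := fun l => if l ≤ j then p l else d
      have hq : q (j + 1) = d := by simp [q]
      have hq0 : q 0 = p 0 := by simp [q]
      have := ihm (σ d) (by rw [← hm]; exact hdk) (j + 1) q (by rw [hq])
        (by rw [hq, hq0]; exact h) ?_ ?_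
      · rw [hq0, hq] at this
        exact hxd this
      · intro l hl
        rcases (Nat.lt_succ_iff.1 hl).lt_or_eq with h1 | rfl
        · have h2 : l + 1 ≤ j := h1
          simp only [q, h1.le, h2, if_true]
          exact hstep l (by omega)
        · rw [hq]
          simpa [q] using hjd
      · intro l hl0 hl
        have h1 : l ≤ j := by omega
        rw [hq]
        simp only [q, h1, if_true]
        exact hdk.trans_le (hlater l hl0 (by omega))
    · exact hd0 (σ.injective h)
    · let q : ℕ → V := fun l => if l = 0 then d else p (j + 1 - l)
      have hq : q (j + 1) = p 0 := by simp [q]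
      have hq0 : q 0 = d := by simp [q]
      have := ihm (σ (p 0)) (by rw [← hm]; exact h0k) (j + 1) q (by rw [hq])
        (by rw [hq, hq0]; exact h) ?_ ?_
      · rw [hq0, hq] at this
        exact hxd this.symm
      · intro l hl
        rcases Nat.eq_zero_or_pos l with rfl | h1
        · simpa [q] using hjd.symm
        · have h2 : l ≠ 0 := by omega
          have h3 : l + 1 ≠ 0 := by omega
          simp only [q, h2, h3, if_false]
          rw [show j + 1 - l = (j + 1 - (l + 1)) + 1 by omega]
          exact (hstep _ (by omega)).symm
      · intro l hl0 hl
        have h1 : l ≠ 0 := by omega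
        rw [hq]
        simp only [q, h1, if_false]
        exact h0k.trans_le (hlater _ (by omega) (by omega))

/-- In a maximum cardinality search of a chordal graph, two vertices joined by a path whose inner
vertices are all visited after both of them are adjacent. -/
theorem IsMCSOrdering.adj_of_path (hG : IsChordal G) (hσ : IsMCSOrdering G σ) (p : ℕ → V) (k : ℕ)
    (hne : p 0 ≠ p k) (hstep : ∀ i < k, G.Adj (p i) (p (i + 1)))
    (h0 : ∀ i, 0 < i → i < k → σ (p 0) < σ (p i))
    (hk : ∀ i, 0 < i → i < k → σ (p k) < σ (p i)) : G.Adj (p 0) (p k) := by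
  rcases lt_trichotomy (σ (p 0)) (σ (p k)) with h | h | h
  · exact hσ.adj_of_path_aux hG _ k p rfl h hstep hk
  · exact absurd (σ.injective h) hne
  · have := hσ.adj_of_path_aux hG _ k (fun i => p (k - i)) rfl (by simpa using h) ?_ ?_
    · simpa using this.symm
    · intro i hi
      have := (hstep (k - (i + 1)) (by omega)).symm
      rwa [show k - (i + 1) + 1 = k - i by omega] at this
    · intro i h1 h2
      simpa using h0 (k - i) (by omega) (by omega)

/-- The reverse of a maximum cardinality search of a chordal graph is a perfect elimination
ordering. -/
theorem IsMCSOrdering.isClique_earlierNeighbors (hG : IsChordal G) (hσ : IsMCSOrdering G σ)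
    {v x y : V} (hx : x ∈ earlierNeighbors G σ v) (hy : y ∈ earlierNeighbors G σ v) (hxy : x ≠ y) :
    G.Adj x y := by
  have := hσ.adj_of_path hG (fun i => if i = 0 then x else if i = 1 then v else y) 2
    (by simpa using hxy) ?_ ?_ ?_
  · simpa using this
  · intro i hi
    interval_cases i
    · simpa using hx.1.symm
    · simpa using hy.1
  · intro i h1 h2
    obtain rfl : i = 1 := by omega
    simpa using hx.2
  · intro i h1 h2
    obtain rfl : i = 1 := by omega
    simpa using hy.2

/-! ### Connected sets and their boundaries -/

/-- `C` induces a connected subgraph, phrased by cuts: every nonempty proper subset of `C` sends an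
edge to the rest of `C`. -/
def IsLinked (G : SimpleGraph V) (C : Set V) : Prop :=
  ∀ X ⊆ C, X.Nonempty → (C \ X).Nonempty → ∃ a ∈ X, ∃ b ∈ C \ X, G.Adj a b

/-- The vertices outside `C` that have a neighbor in `C`. -/
def boundary (G : SimpleGraph V) (C : Set V) : Set V :=
  {w | w ∉ C ∧ ∃ c ∈ C, G.Adj c w}

/-- The connected component of `G - S` that contains `x`, for `x ∉ S`. -/
def componentAvoiding (G : SimpleGraph V) (S : Set V) (x : V) : Set V :=
  {y | Relation.ReflTransGen (fun a b => G.Adj a b ∧ b ∉ S) x y}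

theorem mem_componentAvoiding_self (S : Set V) (x : V) : x ∈ componentAvoiding G S x :=
  Relation.ReflTransGen.refl

theorem notMem_of_mem_componentAvoiding {S : Set V} {x y : V} (hx : x ∉ S)
    (hy : y ∈ componentAvoiding G S x) : y ∉ S := by
  rcases Relation.ReflTransGen.cases_tail hy with rfl | ⟨_, _, h⟩
  exacts [hx, h.2]

theorem mem_componentAvoiding_of_adj {S : Set V} {x y w : V} (hy : y ∈ componentAvoiding G S x)
    (h : G.Adj y w) (hw : w ∉ S) : w ∈ componentAvoiding G S x :=
  Relation.ReflTransGen.tail hy ⟨h, hw⟩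

theorem boundary_componentAvoiding_subset (S : Set V) (x : V) :
    boundary G (componentAvoiding G S x) ⊆ S := by
  rintro w ⟨hw, c, hc, hcw⟩
  by_contra h
  exact hw (mem_componentAvoiding_of_adj hc hcw h)

theorem isLinked_componentAvoiding (S : Set V) (x : V) :
    IsLinked G (componentAvoiding G S x) := by
  have cross : ∀ (P : V → Prop) (y : V), y ∈ componentAvoiding G S x → P x → ¬ P y →
      ∃ a ∈ componentAvoiding G S x, ∃ b ∈ componentAvoiding G S x, P a ∧ ¬ P b ∧ G.Adj a b := by
    intro P y hy hPx
    induction hy with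
    | refl => exact fun h => absurd hPx h
    | @tail b c hb hbc ih =>
      intro hPc
      by_cases hPb : P b
      · exact ⟨b, hb, c, hb.tail hbc, hPb, hPc, hbc.1⟩
      · exact ih hPb
  rintro X hXC ⟨y, hy⟩ ⟨w, hwC, hwX⟩
  by_cases hx : x ∈ X
  · obtain ⟨a, ha, b, hb, h1, h2, h3⟩ := cross (· ∈ X) w hwC hx hwX
    exact ⟨a, h1, b, ⟨hb, h2⟩, h3⟩
  · obtain ⟨a, ha, b, hb, h1, h2, h3⟩ := cross (· ∉ X) y (hXC hy) hx (not_not.2 hy)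
    exact ⟨b, not_not.1 h2, a, ⟨ha, h1⟩, h3.symm⟩

/-- Inside a connected set, only the vertex visited first has no earlier neighbor. -/
theorem IsMCSOrdering.exists_earlier_neighbor (hG : IsChordal G) (hσ : IsMCSOrdering G σ)
    {C : Set V} (hC : IsLinked G C) {c v : V} (hc : c ∈ C) (hv : v ∈ C) (hcv : σ c < σ v) :
    ∃ w ∈ C, σ w < σ v ∧ G.Adj v w := by
  let X : Set V := {q | q ∈ C ∧ ∃ (p : ℕ → V) (k : ℕ), p 0 = q ∧ p k = v ∧
    (∀ i < k, G.Adj (p i) (p (i + 1))) ∧ ∀ i < k, σ v < σ (p i)}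
  have hvX : v ∈ X := ⟨hv, fun _ => v, 0, rfl, rfl, by simp, by simp⟩
  have hcX : c ∉ X := by
    rintro ⟨-, p, k, h0, hk, -, hlt⟩
    rcases Nat.eq_zero_or_pos k with rfl | h
    · rw [← h0, hk] at hcv
      exact lt_irrefl _ hcv
    · have := hlt 0 h
      rw [h0] at this
      exact lt_asymm hcv this
  obtain ⟨a, ⟨-, p, k, h0, hk, hstep, hlt⟩, b, ⟨hbC, hbX⟩, hab⟩ :=
    hC X (fun _ h => h.1) ⟨v, hvX⟩ ⟨c, hc, hcX⟩
  let q : ℕ → V := fun i => if i = 0 then b else p (i - 1)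
  have hq0 : q 0 = b := by simp [q]
  have hqk : q (k + 1) = v := by simp [q, hk]
  have hqstep : ∀ i < k + 1, G.Adj (q i) (q (i + 1)) := by
    intro i hi
    rcases Nat.eq_zero_or_pos i with rfl | h
    · simpa [q, h0] using hab.symm
    · have h2 : i ≠ 0 := by omega
      simp only [q, h2, if_false, Nat.add_sub_cancel, Nat.add_eq_zero_iff, one_ne_zero, and_false]
      have := hstep (i - 1) (by omega)
      rwa [show i - 1 + 1 = i by omega] at this
  have hqlt : ∀ i, 0 < i → i < k + 1 → σ v < σ (q i) := by
    intro i h1 h2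
    have h3 : i ≠ 0 := by omega
    simp only [q, h3, if_false]
    exact hlt _ (by omega)
  have hbv : σ b < σ v := by
    rcases lt_trichotomy (σ b) (σ v) with h | h | h
    · exact h
    · exact absurd hvX (σ.injective h ▸ hbX)
    · refine absurd ⟨hbC, q, k + 1, hq0, hqk, hqstep, ?_⟩ hbX
      intro i hi
      rcases Nat.eq_zero_or_pos i with rfl | h1
      · rwa [hq0]
      · exact hqlt i h1 hi
  refine ⟨b, hbC, hbv, ?_⟩
  have := hσ.adj_of_path hG q (k + 1) ?_ hqstep ?_ ?_
  · rw [hq0, hqk] at this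
    exact this.symm
  · rw [hq0, hqk]
    rintro rfl
    exact lt_irrefl _ hbv
  · intro i h1 h2
    rw [hq0]
    exact hbv.trans (hqlt i h1 h2)
  · intro i h1 h2
    rw [hqk]
    exact hqlt i h1 h2

/-- A connected set of unvisited vertices contains a vertex that sees all visited vertices on the
boundary of the set; hence at that moment the largest label is at least the size of the boundary of
each component of the unvisited part. -/
theorem IsMCSOrdering.exists_complete (hG : IsChordal G) (hσ : IsMCSOrdering G σ)
    {C : Set V} (hC : IsLinked G C) (hne : C.Nonempty) (x : V) (hCx : ∀ v ∈ C, σ x ≤ σ v)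
    (hb : ∀ w ∈ boundary G C, σ w < σ x) :
    ∃ c ∈ C, (∀ w ∈ boundary G C, G.Adj c w) ∧
      (boundary G C).ncard ≤ visitedNeighbors G σ x c := by
  obtain ⟨c, hc, hmin⟩ := exists_first σ hne
  have key : ∀ (m : ℕ) (v : V), v ∈ C → (σ v : ℕ) = m → ∀ w, σ w < σ x → G.Adj v w →
      G.Adj c w := by
    intro m
    induction m using Nat.strong_induction_on with
    | _ m ih =>
    intro v hv hm w hw hvw
    rcases (hmin v hv).lt_or_eq with h | h
    · obtain ⟨y, hyC, hyv, hvy⟩ := hσ.exists_earlier_neighbor hG hC hc hv h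
      refine ih (σ y) (by rw [← hm]; exact hyv) y hyC rfl w hw ?_
      refine hσ.isClique_earlierNeighbors hG (v := v) ⟨hvy, hyv⟩
        ⟨hvw, hw.trans_le (hCx v hv)⟩ ?_
      rintro rfl
      exact absurd (hCx y hyC) (not_le.2 hw)
    · rw [σ.injective h]
      exact hvw
  have hall : ∀ w ∈ boundary G C, G.Adj c w := by
    intro w hw
    obtain ⟨v, hv, hvw⟩ := hw.2
    exact key _ v hv rfl w (hb w hw) hvw
  exact ⟨c, hc, hall, ncard_mono σ fun w hw => ⟨hall w hw, hb w hw⟩⟩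

end MCS

/-! ### Breaks and records of a maximum cardinality search -/

section Records

variable {V : Type*} {n : ℕ} {G : SimpleGraph V} {π : V ≃ Fin n}

/-- A break of an ordering: a vertex visited with a label no larger than that of its predecessor.
In a search of a chordal graph the breaks are the places where a new maximal clique is started;
away from them the labels grow by one at each step. -/
def IsBreak (G : SimpleGraph V) (π : V ≃ Fin n) (v : V) : Prop :=
  ∃ w, (π w : ℕ) + 1 = π v ∧ visitedNeighbors G π v v ≤ visitedNeighbors G π w w

/-- A record: a vertex `d` such that all later breaks have larger labels than `d`. -/
def IsRecord (G : SimpleGraph V) (π : V ≃ Fin n) (d : V) : Prop :=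
  ∀ b, IsBreak G π b → π d < π b → visitedNeighbors G π d d < visitedNeighbors G π b b

/-- The vertices visited from `d` on. -/
def tailFrom (π : V ≃ Fin n) (d : V) : Set V := {v | π d ≤ π v}

/-- `v` is visited after `d` with no break in between. -/
def InRun (G : SimpleGraph V) (π : V ≃ Fin n) (d v : V) : Prop :=
  π d ≤ π v ∧ ∀ b, IsBreak G π b → π d < π b → ¬ π b ≤ π v

theorem exists_predecessor (π : V ≃ Fin n) {d v : V} (h : π d < π v) :
    ∃ w, (π w : ℕ) + 1 = π v ∧ π d ≤ π w := by
  have h' : (π d : ℕ) < π v := h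
  refine ⟨π.symm ⟨(π v : ℕ) - 1, by have := (π v).2; omega⟩, ?_, ?_⟩
  · simp only [Equiv.apply_symm_apply]
    omega
  · rw [Equiv.apply_symm_apply, Fin.le_def]
    change (π d : ℕ) ≤ (π v : ℕ) - 1
    omega

theorem tail_induction (π : V ≃ Fin n) (d : V) {P : V → Prop} (h0 : P d)
    (hs : ∀ w v, π d ≤ π w → (π w : ℕ) + 1 = π v → P w → P v) :
    ∀ v, π d ≤ π v → P v := by
  have key : ∀ (m : ℕ) (v : V), (π v : ℕ) = m → π d ≤ π v → P v := by
    intro m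
    induction m using Nat.strong_induction_on with
    | _ m ih =>
    intro v hm hv
    rcases hv.lt_or_eq with h | h
    · obtain ⟨w, hw, hdw⟩ := exists_predecessor π h
      exact hs w v hdw hw (ih (π w) (by omega) w rfl hdw)
    · rwa [← π.injective h]
  exact fun v hv => key _ v rfl hv

theorem earlierNeighbors_of_not_isBreak (hG : IsChordal G) (hπ : IsMCSOrdering G π) {w v : V}
    (hwv : (π w : ℕ) + 1 = π v) (hv : ¬ IsBreak G π v) :
    earlierNeighbors G π v = insert w (earlierNeighbors G π w) := by
  have hlt : visitedNeighbors G π w w < visitedNeighbors G π v v := by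
    by_contra h
    exact hv ⟨w, hwv, not_lt.1 h⟩
  have hwv' : π w < π v := by rw [Fin.lt_def]; omega
  have hw : w ∈ earlierNeighbors G π v := by
    by_contra hw
    have hsub : earlierNeighbors G π v ⊆ {x | G.Adj v x ∧ π x < π w} := by
      intro x hx
      refine ⟨hx.1, ?_⟩
      have h1 : (π x : ℕ) < π v := hx.2
      have h2 : (π x : ℕ) ≠ π w := by
        intro h
        rw [π.injective (Fin.ext h)] at hx
        exact hw hx
      rw [Fin.lt_def]
      omega
    exact absurd ((ncard_mono π hsub).trans (hπ w v hwv'.le)) (not_le.2 hlt)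
  have hsub : earlierNeighbors G π v ⊆ insert w (earlierNeighbors G π w) := by
    intro x hx
    rcases eq_or_ne x w with rfl | hne
    · exact Set.mem_insert _ _
    · refine Set.mem_insert_of_mem _ ⟨hπ.isClique_earlierNeighbors hG hw hx hne.symm, ?_⟩
      have h1 : (π x : ℕ) < π v := hx.2
      have h2 : (π x : ℕ) ≠ π w := fun h => hne (π.injective (Fin.ext h))
      rw [Fin.lt_def]
      omega
  refine eq_of_subset_of_ncard_le' π hsub ?_
  have := Set.ncard_insert_le w (earlierNeighbors G π w)
  rw [ncard_earlierNeighbors] at *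
  omega

theorem InRun.refl (d : V) : InRun G π d d := ⟨le_rfl, fun _ _ h h' => absurd h' (not_le.2 h)⟩

theorem InRun.pred {d v w : V} (h : InRun G π d v) (hdw : π d ≤ π w)
    (hwv : (π w : ℕ) + 1 = π v) : InRun G π d w ∧ ¬ IsBreak G π v := by
  have hwv' : π w < π v := by rw [Fin.lt_def]; omega
  exact ⟨⟨hdw, fun b hb h1 h2 => h.2 b hb h1 (h2.trans hwv'.le)⟩,
    fun hb => h.2 v hb (hdw.trans_lt hwv') le_rfl⟩

/-- A vertex in the run of `d` sees everything that `d` saw and all of the run before it. -/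
theorem InRun.mem_earlierNeighbors (hG : IsChordal G) (hπ : IsMCSOrdering G π) {d v : V}
    (h : InRun G π d v) :
    ∀ x, (x ∈ earlierNeighbors G π d ∨ (π d ≤ π x ∧ π x < π v)) →
      x ∈ earlierNeighbors G π v := by
  refine tail_induction π d (P := fun v => InRun G π d v → ∀ x, (x ∈ earlierNeighbors G π d ∨
    (π d ≤ π x ∧ π x < π v)) → x ∈ earlierNeighbors G π v) ?_ ?_ v h.1 h
  · rintro - x (hx | hx)
    · exact hx
    · exact absurd hx.1 (not_le.2 hx.2)
  · intro w v hdw hwv ih hv x hx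
    obtain ⟨hrun, hnb⟩ := hv.pred hdw hwv
    rw [earlierNeighbors_of_not_isBreak hG hπ hwv hnb]
    rcases eq_or_ne x w with rfl | hne
    · exact Set.mem_insert _ _
    · refine Set.mem_insert_of_mem _ (ih hrun x (hx.imp_right fun h => ⟨h.1, ?_⟩))
      have h1 : (π x : ℕ) < π v := h.2
      have h2 : (π x : ℕ) ≠ π w := fun h => hne (π.injective (Fin.ext h))
      rw [Fin.lt_def]
      omega

/-- The vertices of a run are pairwise adjacent. -/
theorem InRun.adj (hG : IsChordal G) (hπ : IsMCSOrdering G π) {d v w : V} (hv : InRun G π d v)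
    (hw : InRun G π d w) (hne : v ≠ w) : G.Adj v w := by
  rcases lt_trichotomy (π v) (π w) with h | h | h
  · exact (hw.mem_earlierNeighbors hG hπ v (Or.inr ⟨hv.1, h⟩)).1.symm
  · exact absurd (π.injective h) hne
  · exact (hv.mem_earlierNeighbors hG hπ w (Or.inr ⟨hw.1, h⟩)).1

/-- If all breaks after `d` have labels at least `t`, then so have all vertices after `d` that are
not in the run of `d`. -/
theorem inRun_or_le_label {d : V} {t : ℕ}
    (ht : ∀ b, IsBreak G π b → π d < π b → t ≤ visitedNeighbors G π b b) :
    ∀ v, π d ≤ π v → InRun G π d v ∨ t ≤ visitedNeighbors G π v v := by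
  refine tail_induction π d (Or.inl (InRun.refl d)) ?_
  intro w v hdw hwv ih
  have hwv' : π w < π v := by rw [Fin.lt_def]; omega
  by_cases hb : IsBreak G π v
  · exact Or.inr (ht v hb (hdw.trans_lt hwv'))
  · rcases ih with h | h
    · refine Or.inl ⟨hdw.trans hwv'.le, fun b hb' h1 h2 => ?_⟩
      rcases h2.lt_or_eq with h3 | h3
      · have h4 : (π b : ℕ) < π v := h3
        refine h.2 b hb' h1 ?_
        rw [Fin.le_def]
        omega
      · exact hb (π.injective h3 ▸ hb')
    · right
      by_contra hlt
      exact hb ⟨w, hwv, by omega⟩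

theorem IsRecord.label_lt (hG : IsChordal G) (hπ : IsMCSOrdering G π) {d v : V}
    (hd : IsRecord G π d) (hdv : π d < π v) :
    visitedNeighbors G π d d < visitedNeighbors G π v v := by
  rcases inRun_or_le_label (t := visitedNeighbors G π d d + 1) hd v hdv.le with h | h
  · have hsub : insert d (earlierNeighbors G π d) ⊆ earlierNeighbors G π v := by
      rintro x (rfl | hx)
      · exact h.mem_earlierNeighbors hG hπ x (Or.inr ⟨le_rfl, hdv⟩)
      · exact h.mem_earlierNeighbors hG hπ x (Or.inl hx)
    have hd' : d ∉ earlierNeighbors G π d := fun h => lt_irrefl _ h.2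
    have := finite_of_ordering π
    have h1 := ncard_mono π hsub
    rw [Set.ncard_insert_of_notMem hd' (Set.toFinite _)] at h1
    exact h1
  · exact h

theorem IsRecord.exists_earlier (hG : IsChordal G) (hπ : IsMCSOrdering G π) {d v : V}
    (hd : IsRecord G π d) (hdv : π d < π v) : ∃ y ∈ earlierNeighbors G π v, π d ≤ π y := by
  by_contra! hcon
  have h1 : visitedNeighbors G π v v ≤ visitedNeighbors G π d v :=
    ncard_mono π fun x hx => ⟨hx.1, hcon x hx⟩
  have h2 := hπ d v hdv.le
  have h3 := hd.label_lt hG hπ hdv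
  omega

/-- The vertices from a record on are attached to the earlier ones through the clique that the
record sees. -/
theorem IsRecord.mem_earlierNeighbors (hG : IsChordal G) (hπ : IsMCSOrdering G π) {d : V}
    (hd : IsRecord G π d) {v w : V} (hv : π d ≤ π v) (hw : π w < π d) (hvw : G.Adj v w) :
    w ∈ earlierNeighbors G π d := by
  have key : ∀ (m : ℕ) (v : V), (π v : ℕ) = m → π d ≤ π v → G.Adj v w →
      w ∈ earlierNeighbors G π d := by
    intro m
    induction m using Nat.strong_induction_on with
    | _ m ih =>
    intro v hm hv hvw
    rcases hv.lt_or_eq with h | h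
    · obtain ⟨y, hy, hdy⟩ := hd.exists_earlier hG hπ h
      refine ih (π y) (by rw [← hm]; exact hy.2) y rfl hdy ?_
      refine hπ.isClique_earlierNeighbors hG hy ⟨hvw, hw.trans h⟩ ?_
      rintro rfl
      exact absurd hdy (not_le.2 hw)
    · rw [π.injective h]
      exact ⟨hvw, hw.trans_le hv⟩
  exact key _ v rfl hv hvw

theorem IsRecord.isLinked (hG : IsChordal G) (hπ : IsMCSOrdering G π) {d : V}
    (hd : IsRecord G π d) : IsLinked G (tailFrom π d) := by
  rintro X hX hXne hcompl
  by_cases hdX : d ∈ X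
  · obtain ⟨c, ⟨hc, hcX⟩, hmin⟩ := exists_first π hcompl
    have hdc : π d < π c := lt_of_le_of_ne hc fun h => hcX (π.injective h ▸ hdX)
    obtain ⟨y, hy, hdy⟩ := hd.exists_earlier hG hπ hdc
    refine ⟨y, ?_, c, ⟨hc, hcX⟩, hy.1.symm⟩
    by_contra hyX
    exact absurd (hmin y ⟨hdy, hyX⟩) (not_le.2 hy.2)
  · obtain ⟨c, hc, hmin⟩ := exists_first π hXne
    have hdc : π d < π c := lt_of_le_of_ne (hX hc) fun h => hdX (π.injective h ▸ hc)
    obtain ⟨y, hy, hdy⟩ := hd.exists_earlier hG hπ hdc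
    exact ⟨c, hc, y, ⟨hdy, fun hyX => absurd (hmin y hyX) (not_le.2 hy.2)⟩, hy.1⟩

/-! ### Searches that enter the tail of another search -/

/-- A search that starts in the tail `D` of a record `d` visits all of `D` before it leaves `D`
together with the clique `A` through which `D` is attached.  Let `f` be the first vertex outside
`D ∪ A`, and suppose that it precedes `x ∈ D`. The component `C` of `x` in the unvisited part has
a boundary of at most `|A ∩ visited|` vertices; this forces the boundary into `A`, although `C`
is connected to the starting vertex inside `D`. -/
theorem IsRecord.lt_of_start (hG : IsChordal G) (hπ : IsMCSOrdering G π) {σ : V ≃ Fin n}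
    (hσ : IsMCSOrdering G σ) {d u : V} (hd : IsRecord G π d) (hu : IsStartVertex σ u)
    (hdu : π d ≤ π u) {f x : V} (hfd : π f < π d) (hfA : f ∉ earlierNeighbors G π d)
    (hx : π d ≤ π x) : σ x < σ f := by
  obtain ⟨g, ⟨hgd, hgA⟩, hgmin⟩ := exists_first σ
    (X := {g | π g < π d ∧ g ∉ earlierNeighbors G π d}) ⟨f, hfd, hfA⟩
  refine lt_of_lt_of_le ?_ (hgmin f ⟨hfd, hfA⟩)
  by_contra hgx
  have hgx : σ g ≤ σ x := not_lt.1 hgx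
  set T : Set V := {v | σ v < σ g} with hT
  set A : Set V := earlierNeighbors G π d with hA
  have hxT : x ∉ T := not_lt.2 hgx
  have huT : u ∈ T := by
    have h1 : σ u ≠ σ g := fun h => absurd (σ.injective h ▸ hdu) (not_le.2 hgd)
    have h2 : (σ u : ℕ) = 0 := hu
    have h3 : (σ u : ℕ) ≠ σ g := fun h => h1 (Fin.ext h)
    rw [hT, Set.mem_ofPred_eq, Fin.lt_def]
    omega
  set C : Set V := componentAvoiding G T x with hC
  have hCT : ∀ v ∈ C, v ∉ T := fun v hv => notMem_of_mem_componentAvoiding hxT hv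
  have hxC : x ∈ C := mem_componentAvoiding_self T x
  have hbT : boundary G C ⊆ T := boundary_componentAvoiding_subset T x
  have hgT : {w | G.Adj g w ∧ σ w < σ g} ⊆ A ∩ T := by
    rintro w ⟨hgw, hwT⟩
    refine ⟨?_, hwT⟩
    rcases lt_or_ge (π w) (π d) with h | h
    · by_contra hwA
      exact absurd (hgmin w ⟨h, hwA⟩) (not_le.2 hwT)
    · exact absurd (hd.mem_earlierNeighbors hG hπ h hgd hgw.symm) hgA
  have hcard : (boundary G C).ncard ≤ (A ∩ T).ncard := by
    obtain ⟨c, hc, -, hle⟩ := hσ.exists_complete hG (isLinked_componentAvoiding T x) ⟨x, hxC⟩ g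
      (fun v hv => not_lt.1 (hCT v hv)) hbT
    exact hle.trans ((hσ g c (not_lt.1 (hCT c hc))).trans (ncard_mono σ hgT))
  have hbA : boundary G C ⊆ A := by
    by_cases hCD : C ⊆ tailFrom π d
    · obtain ⟨c, hc, hmin⟩ := exists_first π ⟨x, hxC⟩
      have hcb : earlierNeighbors G π c ⊆ boundary G C := fun w hw =>
        ⟨fun hwC => absurd (hmin w hwC) (not_le.2 hw.2), c, hc, hw.1⟩
      have h1 := (ncard_mono π hcb).trans (hcard.trans (ncard_mono π Set.inter_subset_left))
      have hcd : c = d := by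
        by_contra hne
        have hlt : π d < π c := lt_of_le_of_ne (hCD hc) fun h => hne (π.injective h.symm)
        exact absurd h1 (not_le.2 (hd.label_lt hG hπ hlt))
      subst hcd
      have := eq_of_subset_of_ncard_le' π hcb (hcard.trans (ncard_mono π Set.inter_subset_left))
      rw [← this]
    · obtain ⟨v, hvC, hvD⟩ := Set.not_subset.1 hCD
      obtain ⟨a, ⟨haC, haD⟩, b, ⟨hbC, hbD⟩, hab⟩ := isLinked_componentAvoiding T x
        (C ∩ tailFrom π d) Set.inter_subset_left ⟨x, hxC, hx⟩ ⟨v, hvC, fun h => hvD h.2⟩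
      have hbd : π b < π d := not_le.1 fun h => hbD ⟨hbC, h⟩
      have hbA : b ∈ A := hd.mem_earlierNeighbors hG hπ haD hbd hab
      have hsub : A ∩ T ⊆ boundary G C := by
        rintro w ⟨hwA, hwT⟩
        refine ⟨fun hwC => hCT w hwC hwT, b, hbC, ?_⟩
        refine hπ.isClique_earlierNeighbors hG hbA hwA ?_
        rintro rfl
        exact hCT b hbC hwT
      rw [← eq_of_subset_of_ncard_le' π hsub hcard]
      exact Set.inter_subset_left
  obtain ⟨a, ⟨haC, haD⟩, b, ⟨hbD, hbC⟩, hab⟩ := hd.isLinked hG hπ (C ∩ tailFrom π d)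
    Set.inter_subset_right ⟨x, hxC, hx⟩ ⟨u, hdu, fun h => hCT u h.1 huT⟩
  have hb : b ∈ A := hbA ⟨fun h => hbC ⟨h, hbD⟩, a, haC, hab⟩
  exact absurd hb.2 (not_lt.2 hbD)

/-- Suppose that the tail `D` of `d` is attached through the clique `A` that `d` sees, and that its
labels drop below `t` only in the run of `d`. Then a set `C ⊆ D` with fewer than `t` boundary
vertices swallows `D ∪ A` up to its boundary: both the first vertex of `C` and the first vertex of
`D` outside `C` and its boundary have labels below `t`, hence they lie in the run of `d`, which
is a clique. -/
theorem subset_union_boundary (hG : IsChordal G) (hπ : IsMCSOrdering G π) {d : V} {t : ℕ}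
    (hatt : ∀ v w, π d ≤ π v → π w < π d → G.Adj v w → w ∈ earlierNeighbors G π d)
    (ht : ∀ b, IsBreak G π b → π d < π b → t ≤ visitedNeighbors G π b b)
    {C : Set V} (hCD : C ⊆ tailFrom π d) (hC : C.Nonempty) (hCt : (boundary G C).ncard < t) :
    tailFrom π d ⊆ C ∪ boundary G C ∧ earlierNeighbors G π d ⊆ boundary G C := by
  obtain ⟨c, hc, hmin⟩ := exists_first π hC
  have hcb : earlierNeighbors G π c ⊆ boundary G C := fun w hw =>
    ⟨fun hwC => absurd (hmin w hwC) (not_le.2 hw.2), c, hc, hw.1⟩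
  have hcrun : InRun G π d c := by
    rcases inRun_or_le_label ht c (hCD hc) with h | h
    · exact h
    · exact absurd ((h.trans (ncard_mono π hcb)).trans_lt hCt) (lt_irrefl _)
  have hA : earlierNeighbors G π d ⊆ boundary G C := fun w hw =>
    hcb (hcrun.mem_earlierNeighbors hG hπ w (Or.inl hw))
  refine ⟨?_, hA⟩
  by_contra hcon
  obtain ⟨v, hvD, hv⟩ := Set.not_subset.1 hcon
  obtain ⟨w, ⟨hwD, hw⟩, hwmin⟩ := exists_first π
    (X := {w | w ∈ tailFrom π d ∧ w ∉ C ∪ boundary G C}) ⟨v, hvD, hv⟩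
  have hsub : earlierNeighbors G π w ⊆ boundary G C := by
    intro y hy
    rcases lt_or_ge (π y) (π d) with h | h
    · exact hA (hatt w y hwD h hy.1)
    · by_cases hyC : y ∈ C
      · exact absurd (Or.inr ⟨fun h => hw (Or.inl h), y, hyC, hy.1.symm⟩) hw
      · by_contra hyb
        exact absurd (hwmin y ⟨h, fun h => h.elim hyC hyb⟩) (not_le.2 hy.2)
  rcases inRun_or_le_label ht w hwD with h | h
  · refine hw (Or.inr ⟨fun h => hw (Or.inl h), c, hc, ?_⟩)
    refine hcrun.adj hG hπ h ?_
    rintro rfl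
    exact hw (Or.inl hc)
  · exact absurd ((h.trans (ncard_mono π hsub)).trans_lt hCt) (lt_irrefl _)

/-- If `y` precedes a break `b` and all breaks after `y` have labels at least `t`, the run of `y`
completes a clique of more than `t` vertices before `b`. -/
theorem exists_large_clique (hG : IsChordal G) (hπ : IsMCSOrdering G π) {y b : V} {t : ℕ}
    (hb : IsBreak G π b) (hyb : π y < π b)
    (ht : ∀ b, IsBreak G π b → π y < π b → t ≤ visitedNeighbors G π b b) :
    ∃ Q : Set V, t < Q.ncard ∧ (∀ v ∈ Q, π v < π b) ∧ (∀ v ∈ Q, ∀ w ∈ Q, v ≠ w → G.Adj v w) ∧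
      y ∈ Q ∧ earlierNeighbors G π y ⊆ Q := by
  -- `b'` is the first break after `y`, and `Q` consists of its predecessor `j` and what `j` sees.
  obtain ⟨b', ⟨hb', hyb'⟩, hmin⟩ := exists_first π
    (X := {b' | IsBreak G π b' ∧ π y < π b'}) ⟨b, hb, hyb⟩
  obtain ⟨j, hj, hle⟩ := hb'
  have hjb' : π j < π b' := by rw [Fin.lt_def]; omega
  have hyj : π y ≤ π j := by
    have : (π y : ℕ) < π b' := hyb'
    rw [Fin.le_def]
    omega
  have hrun : InRun G π y j :=
    ⟨hyj, fun c hc h1 h2 => absurd (hmin c ⟨hc, h1⟩) (not_le.2 (h2.trans_lt hjb'))⟩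
  have hj' : j ∉ earlierNeighbors G π j := fun h => lt_irrefl _ h.2
  have hjb : π j < π b := hjb'.trans_le (hmin b ⟨hb, hyb⟩)
  refine ⟨insert j (earlierNeighbors G π j), ?_, ?_, ?_, ?_, ?_⟩
  · have := finite_of_ordering π
    rw [Set.ncard_insert_of_notMem hj' (Set.toFinite _)]
    exact Nat.lt_succ_of_le ((ht b' ⟨j, hj, hle⟩ hyb').trans hle)
  · rintro v (rfl | hv)
    · exact hjb
    · exact hv.2.trans hjb
  · rintro v (rfl | hv) w (rfl | hw) hne
    · exact absurd rfl hne
    · exact hw.1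
    · exact hv.1.symm
    · exact hπ.isClique_earlierNeighbors hG hv hw hne
  · rcases hyj.lt_or_eq with h | h
    · exact Set.mem_insert_of_mem _ (hrun.mem_earlierNeighbors hG hπ y (Or.inr ⟨le_rfl, h⟩))
    · rw [π.injective h]
      exact Set.mem_insert _ _
  · exact fun w hw => Set.mem_insert_of_mem _ (hrun.mem_earlierNeighbors hG hπ w (Or.inl hw))

end Records

section EndVertex

variable {V : Type*} {n : ℕ} {G : SimpleGraph V} {π : V ≃ Fin n}

/-- Let `τ` enter the tail `D'` of a record break `d'` at `x` when it has visited everything before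
`d` in `π`, but not yet everything before `d'`. Then an unvisited vertex `f` outside `D'` and
outside the clique through which `D'` is attached has at that moment a label as large as that of
`x`. -/
theorem exists_competitor (hG : IsChordal G) (hπ : IsMCSOrdering G π) {τ : V ≃ Fin n}
    (hτ : IsMCSOrdering G τ) {d d' x e : V}
    (hatt : ∀ v w, π d ≤ π v → π w < π d → G.Adj v w → w ∈ earlierNeighbors G π d)
    (hd' : IsRecord G π d') (hb' : IsBreak G π d') (hdd' : π d < π d')
    (ht : ∀ b, IsBreak G π b → π d < π b → visitedNeighbors G π d' d' ≤ visitedNeighbors G π b b)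
    (hbefore : ∀ v, π v < π d → τ v < τ x) (hx : π d' ≤ π x)
    (hafter : ∀ v, π d' ≤ π v → τ x ≤ τ v) (hed' : π e < π d')
    (hxe : τ x ≤ τ e) :
    ∃ f, τ x ≤ τ f ∧ π f < π d' ∧ f ∉ earlierNeighbors G π d' ∧
      visitedNeighbors G τ x x ≤ visitedNeighbors G τ x f := by
  set A' : Set V := earlierNeighbors G π d' with hA'
  set S : Set V := {v | τ v < τ x} with hS
  have hxS : x ∉ S := fun h => lt_irrefl (τ x) h
  have hNx : earlierNeighbors G τ x ⊆ A' := by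
    intro w hw
    refine hd'.mem_earlierNeighbors hG hπ hx ?_ hw.1
    by_contra h
    exact absurd (hafter w (not_lt.1 h)) (not_le.2 hw.2)
  have hSD : ∀ v, v ∉ S → π d ≤ π v := fun v hv => not_lt.1 fun h => hv (hbefore v h)
  by_cases hcase : A'.ncard ≤ (earlierNeighbors G τ x).ncard
  · -- The whole attaching clique `A'` has been visited, so it separates `e` from `D'`.
    have hAS : A' ⊆ S := by
      rw [← eq_of_subset_of_ncard_le' π hNx hcase]
      exact fun w hw => hw.2
    have heS : e ∉ S := not_lt.2 hxe
    set C : Set V := componentAvoiding G S e with hC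
    have heC : e ∈ C := mem_componentAvoiding_self S e
    have hCS : ∀ v ∈ C, v ∉ S := fun v hv => notMem_of_mem_componentAvoiding heS hv
    have hCD' : ∀ v ∈ C, π v < π d' := by
      by_contra! hcon
      obtain ⟨v, hv, hvd⟩ := hcon
      obtain ⟨a, ⟨haC, ha⟩, b, ⟨hbC, hb⟩, hab⟩ := isLinked_componentAvoiding S e
        (C ∩ tailFrom π d') Set.inter_subset_left ⟨v, hv, hvd⟩
        ⟨e, heC, fun h => absurd h.2 (not_le.2 hed')⟩
      have hbd : π b < π d' := not_le.1 fun h => hb ⟨hbC, h⟩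
      exact hCS b hbC (hAS (hd'.mem_earlierNeighbors hG hπ ha hbd hab))
    by_cases hCt : (boundary G C).ncard < A'.ncard
    · have h := (subset_union_boundary hG hπ hatt ht (fun v hv => hSD v (hCS v hv)) ⟨e, heC⟩
        hCt).1 (show π d ≤ π x from hdd'.le.trans hx)
      rcases h with h | h
      · exact absurd (hCD' x h) (not_lt.2 hx)
      · exact absurd (boundary_componentAvoiding_subset S e h) hxS
    · obtain ⟨f, hf, -, hle⟩ := hτ.exists_complete hG (isLinked_componentAvoiding S e) ⟨e, heC⟩ x
        (fun v hv => not_lt.1 (hCS v hv)) (boundary_componentAvoiding_subset S e)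
      refine ⟨f, not_lt.1 (hCS f hf), hCD' f hf, fun h => hCS f hf (hAS h), ?_⟩
      exact (ncard_mono π hNx).trans ((not_lt.1 hCt).trans hle)
  · -- The component `C` of `x` has fewer than `t` boundary vertices, all of which `x` sees.
    have hcase : (earlierNeighbors G τ x).ncard < A'.ncard := not_le.1 hcase
    set C : Set V := componentAvoiding G S x with hC
    have hxC : x ∈ C := mem_componentAvoiding_self S x
    have hCS : ∀ v ∈ C, v ∉ S := fun v hv => notMem_of_mem_componentAvoiding hxS hv
    have hbS : boundary G C ⊆ S := boundary_componentAvoiding_subset S x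
    have hNxC : earlierNeighbors G τ x ⊆ boundary G C := fun w hw =>
      ⟨fun h => hCS w h hw.2, x, hxC, hw.1⟩
    have hNx' : earlierNeighbors G τ x = boundary G C := by
      refine eq_of_subset_of_ncard_le' π hNxC ?_
      obtain ⟨c, hc, -, hle⟩ := hτ.exists_complete hG (isLinked_componentAvoiding S x) ⟨x, hxC⟩ x
        (fun v hv => not_lt.1 (hCS v hv)) hbS
      exact hle.trans (hτ x c (not_lt.1 (hCS c hc)))
    have hCD : C ⊆ tailFrom π d := fun v hv => hSD v (hCS v hv)
    obtain ⟨hDC, hAC⟩ := subset_union_boundary hG hπ hatt ht hCD ⟨x, hxC⟩ (hNx' ▸ hcase)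
    -- A vertex `y ∈ D` before `d'` whose run contains the boundary of `C`.
    obtain ⟨y, hyd, hyd', hy⟩ : ∃ y, π d ≤ π y ∧ π y < π d' ∧
        boundary G C ⊆ insert y (earlierNeighbors G π y) := by
      by_cases hne : (boundary G C ∩ tailFrom π d).Nonempty
      · obtain ⟨y, ⟨hyC, hyd⟩, hmax⟩ := exists_last π hne
        refine ⟨y, hyd, ?_, ?_⟩
        · rw [← hNx'] at hyC
          exact (hNx hyC).2
        · intro w hw
          rcases eq_or_ne w y with rfl | hwy
          · exact Set.mem_insert _ _
          · refine Set.mem_insert_of_mem _ ⟨?_, ?_⟩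
            · rw [← hNx'] at hw hyC
              exact hτ.isClique_earlierNeighbors hG hyC hw hwy.symm
            · rcases lt_or_ge (π w) (π d) with h | h
              · exact h.trans_le hyd
              · exact lt_of_le_of_ne (hmax w ⟨hw, h⟩) fun h => hwy (π.injective h)
      · refine ⟨d, le_rfl, hdd', fun w hw => Set.mem_insert_of_mem _ ?_⟩
        obtain ⟨c, hc, hcw⟩ := hw.2
        refine hatt c w (hCD hc) ?_ hcw
        exact not_le.1 fun h => hne ⟨w, hw, h⟩
    obtain ⟨Q, hQt, hQd', hQ, hyQ, hyQ'⟩ := exists_large_clique hG hπ hb' hyd'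
      (fun b hb h => ht b hb (hyd.trans_lt h))
    have hCQ : boundary G C ⊆ Q := hy.trans (Set.insert_subset hyQ hyQ')
    obtain ⟨f, hfQ, hfA'⟩ : ∃ f ∈ Q, f ∉ A' :=
      Set.not_subset.1 fun h => absurd (ncard_mono π h) (not_le.2 hQt)
    have hfC : f ∉ boundary G C := fun h => hfA' (hNx (hNx' ▸ h))
    refine ⟨f, ?_, hQd' f hfQ, hfA', ncard_mono π fun w hw => ⟨?_, hw.2⟩⟩
    · by_contra hf
      have hfS : f ∈ S := not_le.1 hf
      rcases lt_or_ge (π f) (π d) with h | h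
      · refine hfC (hAC (hatt y f hyd h (hQ y hyQ f hfQ ?_)))
        rintro rfl
        exact absurd hyd (not_le.2 h)
      · exact (hDC h).elim (fun h => hCS f h hfS) hfC
    · have hw' : w ∈ boundary G C := hNx' ▸ hw
      refine hQ f hfQ w (hCQ hw') ?_
      rintro rfl
      exact hfC hw'

/-- If some maximum cardinality search `π` of a chordal graph ends with `u`, and `σ` starts with
`u`, then the search with ties broken by the largest position in `σ` ends with `u`. -/
theorem IsMCSPlusOrdering.isEndVertex (hG : IsChordal G) (hπ : IsMCSOrdering G π)
    {σ τ : V ≃ Fin n} (hσ : IsMCSOrdering G σ) (hτ : IsMCSPlusOrdering G σ τ) {u : V}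
    (hπu : IsEndVertex π u) (hσu : IsStartVertex σ u) : IsEndVertex τ u := by
  have hlast : ∀ v, π v ≤ π u := by
    intro v
    have h1 := (π v).2
    have h2 : (π u : ℕ) + 1 = n := hπu
    rw [Fin.le_def]
    omega
  have hfirst : ∀ v, σ v ≤ σ u → v = u := by
    intro v hv
    have h2 : (σ u : ℕ) = 0 := hσu
    have h1 : (σ v : ℕ) ≤ σ u := hv
    exact σ.injective (Fin.ext (by omega))
  -- The tails considered: those attached through the clique seen by their first vertex, with
  -- large labels at all later breaks, and entered by `τ` only after everything else.
  let Good : V → Prop := fun d =>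
    (∀ v w, π d ≤ π v → π w < π d → G.Adj v w → w ∈ earlierNeighbors G π d) ∧
      ∀ v w, π v < π d → π d ≤ π w → τ v < τ w
  obtain ⟨d, ⟨hatt, hpre⟩, hmax⟩ : ∃ d, Good d ∧ ∀ d', Good d' → π d' ≤ π d := by
    refine exists_last π (X := {d | Good d}) ?_
    obtain ⟨d, -, hd⟩ := exists_first π (X := Set.univ) ⟨u, trivial⟩
    exact ⟨d, fun v w _ h => absurd (hd w trivial) (not_le.2 h),
      fun v w h => absurd (hd v trivial) (not_le.2 h)⟩
  by_cases hbreak : ∃ b, IsBreak G π b ∧ π d < π b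
  · exfalso
    -- `d'` is the last among the breaks after `d` that have the smallest label.
    have hfin := finite_of_ordering π
    obtain ⟨b, ⟨hb, hdb⟩, hbmin⟩ := Set.exists_min_image {b | IsBreak G π b ∧ π d < π b}
      (fun b => visitedNeighbors G π b b) (Set.toFinite _) hbreak
    obtain ⟨d', ⟨hb', hdd', hd'b⟩, hd'max⟩ := exists_last π
      (X := {c | IsBreak G π c ∧ π d < π c ∧ visitedNeighbors G π c c = visitedNeighbors G π b b})
      ⟨b, hb, hdb, rfl⟩
    have hmin : ∀ c, IsBreak G π c → π d < π c →
        visitedNeighbors G π d' d' ≤ visitedNeighbors G π c c := by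
      intro c hc hdc
      rw [hd'b]
      exact hbmin c ⟨hc, hdc⟩
    have hd' : IsRecord G π d' := by
      intro c hc hdc
      refine lt_of_le_of_ne (hmin c hc (hdd'.trans hdc)) fun h => ?_
      exact absurd (hd'max c ⟨hc, hdd'.trans hdc, by rw [← h, hd'b]⟩) (not_le.2 hdc)
    have hnot : ¬ Good d' := fun h => absurd (hmax d' h) (not_le.2 hdd')
    have hatt' : ∀ v w, π d' ≤ π v → π w < π d' → G.Adj v w → w ∈ earlierNeighbors G π d' :=
      fun v w hv hw hvw => hd'.mem_earlierNeighbors hG hπ hv hw hvw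
    obtain ⟨e, y, hed', hy, hye⟩ : ∃ e y, π e < π d' ∧ π d' ≤ π y ∧ τ y ≤ τ e := by
      by_contra! hcon
      exact hnot ⟨hatt', hcon⟩
    obtain ⟨x, hx, hxmin⟩ := exists_first τ (X := tailFrom π d') ⟨y, hy⟩
    have hxe : τ x ≤ τ e := (hxmin y hy).trans hye
    have hbefore : ∀ v, π v < π d → τ v < τ x := fun v hv => hpre v x hv (hdd'.le.trans hx)
    obtain ⟨f, hxf, hfd', hfA, hle⟩ := exists_competitor hG hπ hτ.1 hatt hd' hb' hdd' hmin hbefore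
      hx hxmin hed' hxe
    have h1 : σ f ≤ σ x := hτ.2 x f hxf (le_antisymm (hτ.1 x f hxf) hle)
    exact absurd h1 (not_le.2 (hd'.lt_of_start hG hπ hσ hσu (hlast d') hfd' hfA hx))
  · -- Without further breaks, the tail and its attaching clique form a clique.
    have hrun : ∀ v, π d ≤ π v → InRun G π d v := fun v hv =>
      ⟨hv, fun b hb h _ => hbreak ⟨b, hb, h⟩⟩
    have hall : ∀ v, τ v ≤ τ u := by
      intro v
      by_contra hv
      have huv : τ u < τ v := not_le.1 hv
      have hdv : π d ≤ π v := by
        by_contra h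
        exact lt_asymm huv (hpre v u (not_le.1 h) (hlast d))
      have hle : visitedNeighbors G τ u u ≤ visitedNeighbors G τ u v := by
        refine ncard_mono π fun w hw => ⟨?_, hw.2⟩
        have hwv : w ≠ v := by
          rintro rfl
          exact lt_asymm hw.2 huv
        rcases lt_or_ge (π w) (π d) with h | h
        · exact ((hrun v hdv).mem_earlierNeighbors hG hπ w
            (Or.inl (hatt u w (hlast d) h hw.1))).1
        · exact (hrun v hdv).adj hG hπ (hrun w h) hwv.symm
      have := hfirst v (hτ.2 u v huv.le (le_antisymm (hτ.1 u v huv.le) hle))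
      rw [this] at huv
      exact lt_irrefl _ huv
    have hpos : 0 < n := (τ u).pos
    have h := hall (τ.symm ⟨n - 1, by omega⟩)
    rw [Equiv.apply_symm_apply, Fin.le_def] at h
    have h' := (τ u).2
    change n - 1 ≤ (τ u : ℕ) at h
    change (τ u : ℕ) + 1 = n
    omega

theorem isMCSEndVertex_iff_isEndVertex (hG : IsChordal G) {z : V} {σ τ : V ≃ Fin n}
    (hσ : IsMCSOrdering G σ) (hz : IsStartVertex σ z) (hτ : IsMCSPlusOrdering G σ τ) :
    IsMCSEndVertex G z ↔ IsEndVertex τ z := by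
  constructor
  · rintro ⟨m, π, hπ, hπz⟩
    obtain rfl : m = n := by
      have := Fintype.card_congr (π.symm.trans σ)
      simpa using this
    exact hτ.isEndVertex hG hπ hσ hπz hz
  · exact fun h => ⟨n, τ, hτ.1, h⟩

end EndVertex

/-! ### Existence of searches and the bookkeeping of labels -/

section Search

variable {V : Type*} {n : ℕ} {G : SimpleGraph V}

theorem exists_next_vertex (G : SimpleGraph V) (σ : V ≃ Fin n) (A : Set V) (hA : A ≠ Set.univ) :
    ∃ u ∉ A, ∀ v ∉ A, {x | G.Adj v x ∧ x ∈ A}.ncard ≤ {x | G.Adj u x ∧ x ∈ A}.ncard ∧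
      ({x | G.Adj v x ∧ x ∈ A}.ncard = {x | G.Adj u x ∧ x ∈ A}.ncard → σ v ≤ σ u) := by
  have := finite_of_ordering σ
  obtain ⟨c, hc, hcmax⟩ := Set.exists_max_image Aᶜ (fun v => {x | G.Adj v x ∧ x ∈ A}.ncard)
    (Set.toFinite _) (Set.nonempty_compl.2 hA)
  obtain ⟨u, ⟨hu, huc⟩, humax⟩ := exists_last σ (X := {u | u ∈ Aᶜ ∧
    {x | G.Adj u x ∧ x ∈ A}.ncard = {x | G.Adj c x ∧ x ∈ A}.ncard}) ⟨c, hc, rfl⟩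
  refine ⟨u, hu, fun v hv => ⟨?_, fun h => humax v ⟨hv, h.trans huc⟩⟩⟩
  rw [huc]
  exact hcmax v hv

theorem exists_isMCSPlusOrdering (G : SimpleGraph V) (σ : V ≃ Fin n) :
    ∃ τ : V ≃ Fin n, IsMCSPlusOrdering G σ τ := by
  classical
  have := finite_of_ordering σ
  rcases Nat.eq_zero_or_pos n with rfl | hn
  · exact ⟨σ, fun u => (σ u).elim0, fun u => (σ u).elim0⟩
  have hV : Nonempty V := ⟨σ.symm ⟨0, hn⟩⟩
  have hcard : Nat.card V = n := by simpa using Nat.card_congr σ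
  choose! next hnext hmax using exists_next_vertex G σ
  let A : ℕ → Set V := fun i => Nat.rec ∅ (fun _ B => insert (next B) B) i
  have hA : ∀ i x, x ∈ A i ↔ ∃ j < i, next (A j) = x := by
    intro i x
    induction i with
    | zero => simp [A]
    | succ i ih =>
      change x ∈ insert (next (A i)) (A i) ↔ _
      rw [Set.mem_insert_iff, ih, Nat.exists_lt_succ_right, or_comm, eq_comm (a := x)]
  have hproper : ∀ i < n, A i ≠ Set.univ := by
    intro i hi h
    have hle : ∀ i, (A i).ncard ≤ i := by
      intro i
      induction i with
      | zero => simp [A]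
      | succ i ih => exact (Set.ncard_insert_le _ _).trans (by simpa using ih)
    have := hle i
    rw [h, Set.ncard_univ, hcard] at this
    omega
  let a : Fin n → V := fun i => next (A i)
  have hne : ∀ i j : Fin n, i < j → a i ≠ a j := fun i j hij h =>
    hnext (A j) (hproper j j.2) ((hA j _).2 ⟨i, hij, h⟩)
  have hinj : Function.Injective a := by
    intro i j h
    rcases lt_trichotomy i j with hij | hij | hij
    exacts [absurd h (hne i j hij), hij, absurd h.symm (hne j i hij)]
  have hbij : Function.Bijective a := by
    have := Fintype.ofFinite V
    refine (Fintype.bijective_iff_injective_and_card a).2 ⟨hinj, ?_⟩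
    rw [← Nat.card_eq_fintype_card (α := V), hcard, Fintype.card_fin]
  let τ : V ≃ Fin n := (Equiv.ofBijective a hbij).symm
  have hτ : ∀ u, next (A (τ u)) = u := fun u => Equiv.ofBijective_apply_symm_apply a hbij u
  have hlt : ∀ (u x : V), x ∈ A (τ u) ↔ τ x < τ u := by
    intro u x
    rw [hA]
    constructor
    · rintro ⟨j, hj, h⟩
      have h1 : a ⟨j, hj.trans (τ u).2⟩ = a (τ x) := h.trans (hτ x).symm
      rw [← hinj h1]
      exact hj
    · exact fun h => ⟨τ x, h, hτ x⟩
  have hvis : ∀ u v, visitedNeighbors G τ u v = {x | G.Adj v x ∧ x ∈ A (τ u)}.ncard := by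
    intro u v
    unfold visitedNeighbors
    simp only [hlt]
  have key : ∀ u v, τ u ≤ τ v → visitedNeighbors G τ u v ≤ visitedNeighbors G τ u u ∧
      (visitedNeighbors G τ u v = visitedNeighbors G τ u u → σ v ≤ σ u) := by
    intro u v huv
    have := hmax (A (τ u)) (hproper _ (τ u).2) v (by rw [hlt]; exact not_lt.2 huv)
    rw [hτ u] at this
    rw [hvis, hvis]
    exact this
  exact ⟨τ, fun u v h => (key u v h).1, fun u v h => (key u v h).2⟩

/-- The number that the program stores for the vertex `v` when `i` vertices have been visited: `0`
if `v` has been visited, and one more than the number of visited neighbors of `v` otherwise. -/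
noncomputable def searchLabel (G : SimpleGraph V) (τ : V ≃ Fin n) (i : ℕ) (v : V) : ℕ :=
  open Classical in if (τ v : ℕ) < i then 0 else {x | G.Adj v x ∧ (τ x : ℕ) < i}.ncard + 1

theorem searchLabel_zero (τ : V ≃ Fin n) (v : V) : searchLabel G τ 0 v = 1 := by
  simp [searchLabel]

theorem searchLabel_le (τ : V ≃ Fin n) (i : ℕ) (v : V) : searchLabel G τ i v ≤ n + 1 := by
  unfold searchLabel
  split_ifs
  · omega
  · have := ncard_mono τ (Set.subset_univ {x | G.Adj v x ∧ (τ x : ℕ) < i})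
    have h : (Set.univ : Set V).ncard = n := by
      rw [Set.ncard_univ, Nat.card_congr τ, Nat.card_fin]
    omega

/-- When `u` is visited, its label is the largest one, and `u` has the largest position in `σ` among
the vertices with this label. -/
theorem IsMCSPlusOrdering.searchLabel_le {σ τ : V ≃ Fin n} (h : IsMCSPlusOrdering G σ τ) (u v : V) :
    searchLabel G τ (τ u) v ≤ searchLabel G τ (τ u) u ∧
      (searchLabel G τ (τ u) v = searchLabel G τ (τ u) u → σ v ≤ σ u) := by
  have hu : searchLabel G τ (τ u) u = visitedNeighbors G τ u u + 1 := by
    simp [searchLabel, visitedNeighbors]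
  by_cases hv : τ v < τ u
  · have : searchLabel G τ (τ u) v = 0 := by
      simp [searchLabel, hv]
    rw [this, hu]
    exact ⟨Nat.zero_le _, fun h => by omega⟩
  · have hv' : searchLabel G τ (τ u) v = visitedNeighbors G τ u v + 1 := by
      simp [searchLabel, visitedNeighbors, hv]
    have hle := not_lt.1 hv
    rw [hu, hv']
    exact ⟨Nat.succ_le_succ (h.1 u v hle), fun he => h.2 u v hle (Nat.succ_injective he)⟩

/-- The new labels after the visit of `u`, expressed by truncated subtractions. -/
theorem searchLabel_succ [DecidableEq V] [DecidableRel G.Adj] (τ : V ≃ Fin n) (u v : V) (g a : ℕ)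
    (hg : g = if v = u then 0 else searchLabel G τ (τ u) v)
    (ha : a = if G.Adj v u then 1 else 0) :
    searchLabel G τ (τ u + 1) v = g + (a - (a - g)) := by
  have := finite_of_ordering τ
  rcases lt_trichotomy (τ v : ℕ) (τ u) with h | h | h
  · have hvu : v ≠ u := by
      rintro rfl
      exact lt_irrefl _ h
    have h1 : searchLabel G τ (τ u + 1) v = 0 := by
      simp only [searchLabel, if_pos (Nat.lt_succ_of_lt h)]
    have h2 : searchLabel G τ (τ u) v = 0 := by
      simp only [searchLabel, if_pos h]
    rw [if_neg hvu, h2] at hg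
    omega
  · obtain rfl : v = u := τ.injective (Fin.ext h)
    have h1 : searchLabel G τ (τ v + 1) v = 0 := by
      simp only [searchLabel, if_pos (Nat.lt_succ_self _)]
    rw [if_pos rfl] at hg
    omega
  · have hvu : v ≠ u := by
      rintro rfl
      exact lt_irrefl _ h
    rw [if_neg hvu] at hg
    have h1 : searchLabel G τ (τ u + 1) v = {x | G.Adj v x ∧ (τ x : ℕ) < τ u + 1}.ncard + 1 := by
      simp only [searchLabel, if_neg (show ¬ (τ v : ℕ) < τ u + 1 by omega)]
    have h2 : searchLabel G τ (τ u) v = {x | G.Adj v x ∧ (τ x : ℕ) < τ u}.ncard + 1 := by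
      simp only [searchLabel, if_neg (show ¬ (τ v : ℕ) < τ u by omega)]
    by_cases hadj : G.Adj v u
    · have h3 : {x | G.Adj v x ∧ (τ x : ℕ) < τ u + 1} =
          insert u {x | G.Adj v x ∧ (τ x : ℕ) < τ u} := by
        ext x
        simp only [Set.mem_insert_iff, Set.mem_ofPred_eq]
        constructor
        · rintro ⟨hx, hlt⟩
          rcases (Nat.lt_succ_iff.1 hlt).lt_or_eq with h | h
          · exact Or.inr ⟨hx, h⟩
          · exact Or.inl (τ.injective (Fin.ext h))
        · rintro (rfl | ⟨hx, hlt⟩)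
          · exact ⟨hadj, Nat.lt_succ_self _⟩
          · exact ⟨hx, Nat.lt_succ_of_lt hlt⟩
      rw [if_pos hadj] at ha
      rw [h3, Set.ncard_insert_of_notMem (fun h => lt_irrefl _ h.2) (Set.toFinite _)] at h1
      omega
    · have h3 : {x | G.Adj v x ∧ (τ x : ℕ) < τ u + 1} = {x | G.Adj v x ∧ (τ x : ℕ) < τ u} := by
        ext x
        simp only [Set.mem_ofPred_eq]
        constructor
        · rintro ⟨hx, hlt⟩
          refine ⟨hx, lt_of_le_of_ne (Nat.lt_succ_iff.1 hlt) fun h => ?_⟩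
          rw [τ.injective (Fin.ext h)] at hx
          exact hadj hx
        · rintro ⟨hx, hlt⟩
          exact ⟨hx, Nat.lt_succ_of_lt hlt⟩
      rw [if_neg hadj] at ha
      rw [h3] at h1
      omega

/-- A search with ties broken by `σ` starts with the last vertex of `σ`. -/
theorem IsMCSPlusOrdering.isStartVertex {σ τ : V ≃ Fin n} (h : IsMCSPlusOrdering G σ τ) {z : V}
    (hz : IsEndVertex σ z) : IsStartVertex τ z := by
  have hn : 0 < n := (τ z).pos
  have hzero : ∀ v, visitedNeighbors G τ (τ.symm ⟨0, hn⟩) v = 0 := by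
    intro v
    have : {x | G.Adj v x ∧ τ x < τ (τ.symm ⟨0, hn⟩)} = ∅ := by
      ext x
      simp [Fin.lt_def]
    rw [visitedNeighbors, this, Set.ncard_empty]
  have h1 := h.2 (τ.symm ⟨0, hn⟩) z (by rw [Equiv.apply_symm_apply, Fin.le_def]; exact Nat.zero_le _)
    (by rw [hzero, hzero])
  have h2 : (σ z : ℕ) + 1 = n := hz
  have h3 := (σ (τ.symm ⟨0, hn⟩)).2
  rw [Fin.le_def] at h1
  have h4 : z = τ.symm ⟨0, hn⟩ := σ.injective (Fin.ext (by omega))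
  rw [IsStartVertex, h4, Equiv.apply_symm_apply]

end Search

/-! ### Structured programs for the word RAM -/

/-- Registers and memory of the machine, without the program counter. -/
structure RAMStore where
  reg : ℕ → ℕ
  mem : ℕ → ℕ

/-- The configuration with the given program counter and store. -/
def RAMStore.at (s : RAMStore) (pc : ℕ) : RAMState := ⟨pc, s.reg, s.mem⟩

/-- The effect of an instruction on the store. -/
def RAMInstr.apply (w : ℕ) : RAMInstr → RAMStore → RAMStore
  | .const r k, s => ⟨Function.update s.reg r (k % 2 ^ w), s.mem⟩
  | .add r a b, s => ⟨Function.update s.reg r ((s.reg a + s.reg b) % 2 ^ w), s.mem⟩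
  | .sub r a b, s => ⟨Function.update s.reg r (s.reg a - s.reg b), s.mem⟩
  | .load r a, s => ⟨Function.update s.reg r (s.mem (s.reg a)), s.mem⟩
  | .store a r, s => ⟨s.reg, Function.update s.mem (s.reg a) (s.reg r)⟩
  | .jumpIfZero _ _, s => s

/-- The instruction is not a jump. -/
def RAMInstr.isStraight : RAMInstr → Bool
  | .jumpIfZero _ _ => false
  | _ => true

/-- Structured programs: straight-line code, composition, `skipIfZero r c` (execute `c` unless
register `r` is `0`), and `loopWhileZero c r` (execute `c`, and repeat as long as register `r` is
`0` afterwards). -/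
inductive RAMCode where
  | block (l : List RAMInstr)
  | seq (c d : RAMCode)
  | skipIfZero (r : ℕ) (c : RAMCode)
  | loopWhileZero (c : RAMCode) (r : ℕ)

namespace RAMCode

/-- Machine code for a structured program, to be placed at address `o`. -/
def compile : RAMCode → ℕ → RAMProgram
  | block l, _ => l
  | seq c d, o => c.compile o ++ d.compile (o + (c.compile o).length)
  | skipIfZero r c, o => .jumpIfZero r (o + 1 + (c.compile (o + 1)).length) :: c.compile (o + 1)
  | loopWhileZero c r, o => c.compile o ++ [.jumpIfZero r o]

/-- The machine code for `c`, as a part of any program, takes the store `s` to `s'` in `t` steps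
and continues right behind that code. -/
def Runs (w : ℕ) (c : RAMCode) (s s' : RAMStore) (t : ℕ) : Prop :=
  ∀ (P pre post : RAMProgram), P = pre ++ c.compile pre.length ++ post →
    (P.step w)^[t] (s.at pre.length) = s'.at (pre.length + (c.compile pre.length).length)

/-- Started in `s`, the code `c` finishes within `T` steps in a store that satisfies `Q`. -/
def Ensures (w : ℕ) (c : RAMCode) (T : ℕ) (s : RAMStore) (Q : RAMStore → Prop) : Prop :=
  ∃ t ≤ T, ∃ s', c.Runs w s s' t ∧ Q s'

theorem step_at {P : RAMProgram} {w pc : ℕ} {i : RAMInstr} {s : RAMStore} (h : P[pc]? = some i) :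
    P.step w (s.at pc) = i.exec w (s.at pc) := by
  change (match P[pc]? with | some i => i.exec w (s.at pc) | none => s.at pc) = _
  rw [h]

theorem exec_at {i : RAMInstr} (hi : i.isStraight = true) (w pc : ℕ) (s : RAMStore) :
    i.exec w (s.at pc) = (i.apply w s).at (pc + 1) := by
  cases i <;> first | rfl | simp [RAMInstr.isStraight] at hi

theorem runs_block (w : ℕ) (l : List RAMInstr) (hl : l.all RAMInstr.isStraight = true)
    (s : RAMStore) : (block l).Runs w s (l.foldl (fun s i => i.apply w s) s) l.length := by
  intro P pre post hP
  simp only [compile] at hP ⊢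
  induction l generalizing pre s with
  | nil => simp
  | cons i l ih =>
    simp only [List.all_cons, Bool.and_eq_true] at hl
    have hi : P[pre.length]? = some i := by simp [hP]
    rw [List.length_cons, Function.iterate_succ_apply, step_at hi, exec_at hl.1]
    have := ih hl.2 (i.apply w s) (pre ++ [i]) (by simp [hP])
    simp only [List.length_append, List.length_singleton] at this
    rw [List.foldl_cons, this]
    congr 1
    omega

theorem Runs.seq {w : ℕ} {c d : RAMCode} {s s' s'' : RAMStore} {t t' : ℕ} (hc : c.Runs w s s' t)
    (hd : d.Runs w s' s'' t') : (c.seq d).Runs w s s'' (t + t') := by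
  intro P pre post hP
  simp only [compile] at hP ⊢
  have h1 := hc P pre (d.compile (pre.length + (c.compile pre.length).length) ++ post)
    (by simp [hP])
  have h2 := hd P (pre ++ c.compile pre.length) post (by simp [hP])
  rw [Nat.add_comm t t', Function.iterate_add_apply, h1]
  simp only [List.length_append] at h2 ⊢
  rw [h2]
  congr 1
  omega

theorem ensures_block {w T : ℕ} {l : List RAMInstr} {s : RAMStore} {Q : RAMStore → Prop}
    (hl : l.all RAMInstr.isStraight = true) (hT : l.length ≤ T)
    (h : Q (l.foldl (fun s i => i.apply w s) s)) : (block l).Ensures w T s Q :=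
  ⟨_, hT, _, runs_block w l hl s, h⟩

theorem Ensures.mono {w T T' : ℕ} {c : RAMCode} {s : RAMStore} {Q Q' : RAMStore → Prop}
    (h : c.Ensures w T s Q) (hT : T ≤ T') (hQ : ∀ s, Q s → Q' s) : c.Ensures w T' s Q' := by
  obtain ⟨t, ht, s', hr, hs⟩ := h
  exact ⟨t, ht.trans hT, s', hr, hQ _ hs⟩

theorem Ensures.seq {w T T' : ℕ} {c d : RAMCode} {s : RAMStore} {Q Q' : RAMStore → Prop}
    (hc : c.Ensures w T s Q) (hd : ∀ s, Q s → d.Ensures w T' s Q') :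
    (c.seq d).Ensures w (T + T') s Q' := by
  obtain ⟨t, ht, s', hr, hs⟩ := hc
  obtain ⟨t', ht', s'', hr', hs'⟩ := hd s' hs
  exact ⟨t + t', by omega, s'', hr.seq hr', hs'⟩

theorem ensures_skipIfZero {w T r : ℕ} {c : RAMCode} {s : RAMStore} {Q : RAMStore → Prop}
    (h0 : s.reg r = 0 → Q s) (h1 : s.reg r ≠ 0 → c.Ensures w T s Q) :
    (skipIfZero r c).Ensures w (T + 1) s Q := by
  by_cases h : s.reg r = 0
  · refine ⟨1, by omega, s, ?_, h0 h⟩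
    intro P pre post hP
    simp only [compile] at hP ⊢
    have hi : P[pre.length]? =
        some (.jumpIfZero r (pre.length + 1 + (c.compile (pre.length + 1)).length)) := by
      simp [hP]
    rw [Function.iterate_one, step_at hi]
    simp only [RAMInstr.exec, RAMStore.at, h, if_true, List.length_cons]
    congr 1
    omega
  · obtain ⟨t, ht, s', hr, hs⟩ := h1 h
    refine ⟨t + 1, by omega, s', ?_, hs⟩
    intro P pre post hP
    simp only [compile] at hP ⊢
    have hi : P[pre.length]? =
        some (.jumpIfZero r (pre.length + 1 + (c.compile (pre.length + 1)).length)) := by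
      simp [hP]
    have h2 := hr P (pre ++ [.jumpIfZero r (pre.length + 1 + (c.compile (pre.length + 1)).length)])
      post (by simp [hP])
    rw [Function.iterate_succ_apply, step_at hi]
    simp only [List.length_append, List.length_singleton] at h2
    simp only [RAMInstr.exec, RAMStore.at, h, if_false, List.length_cons] at h2 ⊢
    rw [h2]
    congr 1
    omega

/-- The rule for loops that are executed exactly `k ≥ 1` times: `I i` holds after `i` rounds. -/
theorem ensures_loopWhileZero {w T r k : ℕ} {c : RAMCode} {s : RAMStore} (I : ℕ → RAMStore → Prop)
    (hk : 1 ≤ k) (h0 : I 0 s)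
    (hc : ∀ i < k, ∀ s, I i s →
      c.Ensures w T s fun s' => I (i + 1) s' ∧ (s'.reg r = 0 ↔ i + 1 < k)) :
    (loopWhileZero c r).Ensures w (k * (T + 1)) s (I k) := by
  have key : ∀ m i, i + m + 1 = k → ∀ s, I i s →
      (loopWhileZero c r).Ensures w ((m + 1) * (T + 1)) s (I k) := by
    intro m
    induction m with
    | zero =>
      intro i hi s hs
      obtain ⟨t, ht, s', hr, hs', hz⟩ := hc i (by omega) s hs
      have hz' : s'.reg r ≠ 0 := fun h => absurd (hz.1 h) (by omega)
      refine ⟨t + 1, by omega, s', ?_, by rwa [show i + 1 = k by omega] at hs'⟩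
      intro P pre post hP
      simp only [compile] at hP ⊢
      have h1 := hr P pre ([.jumpIfZero r pre.length] ++ post) (by simp [hP])
      have hi : P[pre.length + (c.compile pre.length).length]? =
          some (.jumpIfZero r pre.length) := by
        simp [hP]
      rw [Function.iterate_succ_apply', h1, step_at hi]
      simp [RAMInstr.exec, RAMStore.at, hz', Nat.add_assoc]
    | succ m ih =>
      intro i hi s hs
      obtain ⟨t, ht, s', hr, hs', hz⟩ := hc i (by omega) s hs
      obtain ⟨t', ht', s'', hr', hs''⟩ := ih (i + 1) (by omega) s' hs'
      have hz' : s'.reg r = 0 := hz.2 (by omega)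
      have hT : t + 1 + t' ≤ (m + 1 + 1) * (T + 1) := by
        rw [Nat.succ_mul (m + 1)]
        omega
      refine ⟨t + 1 + t', hT, s'', ?_, hs''⟩
      intro P pre post hP
      have h2 := hr' P pre post hP
      simp only [compile] at hP
      have h1 := hr P pre ([.jumpIfZero r pre.length] ++ post) (by simp [hP])
      have hi : P[pre.length + (c.compile pre.length).length]? =
          some (.jumpIfZero r pre.length) := by
        simp [hP]
      have h3 : (P.step w)^[t + 1] (s.at pre.length) = s'.at pre.length := by
        rw [Function.iterate_succ_apply', h1, step_at hi]
        simp [RAMInstr.exec, RAMStore.at, hz']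
      rw [Nat.add_comm (t + 1) t', Function.iterate_add_apply, h3, h2]
  obtain ⟨m, rfl⟩ : ∃ m, k = m + 1 := ⟨k - 1, by omega⟩
  exact key m 0 (by omega) s h0

/-- A structured program as a program of its own. -/
theorem Ensures.haltsWithin {w T : ℕ} {c : RAMCode} {s : RAMStore} {Q : RAMStore → Prop}
    (h : c.Ensures w T s Q) :
    (c.compile 0).HaltsWithin w T (s.at 0) fun s' => Q ⟨s'.reg, s'.mem⟩ := by
  obtain ⟨t, ht, s', hr, hs⟩ := h
  have := hr (c.compile 0) [] [] (by simp)
  simp only [List.length_nil, Nat.zero_add] at this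
  exact ⟨t, ht, by rw [this]; exact le_rfl, by rw [this]; exact hs⟩

end RAMCode

/-! ### The search program -/

namespace MCSProgram

open RAMInstr RAMCode

/-- The registers that are fixed while a search runs: the number `n` of vertices, the vertex `z`,
the constant `1`, the addresses `R` of the tie-breaking order, `O` of the output and `L` of the
labels; register `6` counts the vertices visited so far. -/
structure Registers (n z R O L i : ℕ) (s : RAMStore) : Prop where
  r0 : s.reg 0 = n
  r1 : s.reg 1 = z
  r2 : s.reg 2 = 1
  r3 : s.reg 3 = R
  r4 : s.reg 4 = O
  r5 : s.reg 5 = L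
  r6 : s.reg 6 = i

/-- Increase the pointer in register `10` and the loop counter in register `7`, and put into
register `8` the number `0` if and only if the counter is still below `n`. -/
def advance : RAMCode := block [add 10 10 2, add 7 7 2, add 8 7 2, sub 8 8 0]

/-- Set all labels to `1`. -/
def resetLabels : RAMCode :=
  (block [sub 7 7 7, add 10 5 7]).seq (loopWhileZero ((block [store 10 2]).seq advance) 8)

/-- Go through the tie-breaking order and leave in register `12` the last vertex with the largest
label; register `11` holds the largest label met so far. -/
def scan : RAMCode :=
  (block [sub 7 7 7, add 10 3 7, sub 11 11 11]).seq
    (loopWhileZero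
      ((block [load 13 10, add 14 5 13, load 14 14, add 15 14 2, sub 15 15 11]).seq
        ((skipIfZero 15 (block [const 15 0, add 11 14 15, add 12 13 15])).seq
          advance)) 8)

/-- Output the vertex in register `12`, set its label to `0`, and increase the positive labels of
its neighbors, reading a column of the adjacency matrix. -/
def visit : RAMCode :=
  (block [add 10 4 6, store 10 12, add 10 5 12, sub 11 11 11, store 10 11,
      sub 7 7 7, add 10 5 7, add 11 12 7]).seq
    (loopWhileZero ((block [load 13 11, load 14 10, sub 15 13 14, sub 13 13 15, add 14 14 13,
      store 10 14, add 11 11 0]).seq advance) 8)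

/-- Maximum cardinality search with ties broken by the order stored at the address in
register `3`; the result is stored at the address in register `4`. -/
def search : RAMCode :=
  resetLabels.seq ((block [sub 6 6 6]).seq
    (loopWhileZero (scan.seq (visit.seq (block [add 6 6 2, add 8 6 2, sub 8 8 0]))) 8))

variable {n w z R O L i : ℕ}

theorem advance_ensures {p j : ℕ} (hw : n + 2 < 2 ^ w) (hp : p + 1 < 2 ^ w) (hj : j < n)
    {s : RAMStore} (hs : Registers n z R O L i s) (h7 : s.reg 7 = j) (h10 : s.reg 10 = p) :
    advance.Ensures w 4 s fun s' => Registers n z R O L i s' ∧ s'.mem = s.mem ∧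
      s'.reg 7 = j + 1 ∧ s'.reg 10 = p + 1 ∧ (s'.reg 8 = 0 ↔ j + 1 < n) ∧
      s'.reg 11 = s.reg 11 ∧ s'.reg 12 = s.reg 12 := by
  refine ensures_block rfl (by simp) ?_
  obtain ⟨h0, h1, h2, h3, h4, h5, h6⟩ := hs
  refine ⟨⟨?_, ?_, ?_, ?_, ?_, ?_, ?_⟩, ?_, ?_, ?_, ?_, ?_, ?_⟩
  iterate 10 simp (disch := omega) [RAMInstr.apply, *, Nat.mod_eq_of_lt]
  · simp (disch := omega) [RAMInstr.apply, *, Nat.mod_eq_of_lt]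
    omega
  all_goals simp [RAMInstr.apply]

theorem resetLabels_ensures (hn : 1 ≤ n) (hw : L + 2 * n + 2 < 2 ^ w) {s : RAMStore}
    (hs : Registers n z R O L i s) :
    resetLabels.Ensures w (2 + n * 6) s fun s' => Registers n z R O L i s' ∧
      (∀ a < L, s'.mem a = s.mem a) ∧ ∀ v < n, s'.mem (L + v) = 1 := by
  refine Ensures.seq (Q := fun s' => (Registers n z R O L i s' ∧ s'.reg 7 = 0 ∧
      s'.reg 10 = L + 0) ∧ (∀ a < L, s'.mem a = s.mem a) ∧ ∀ v < 0, s'.mem (L + v) = 1) ?_ ?_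
  · refine ensures_block rfl (by simp) ?_
    obtain ⟨h0, h1, h2, h3, h4, h5, h6⟩ := hs
    refine ⟨⟨⟨?_, ?_, ?_, ?_, ?_, ?_, ?_⟩, ?_, ?_⟩, ?_, ?_⟩ <;>
      simp (disch := omega) [RAMInstr.apply, *, Nat.mod_eq_of_lt]
  · intro s₁ hs₁
    refine (ensures_loopWhileZero (fun j s' => (Registers n z R O L i s' ∧ s'.reg 7 = j ∧
      s'.reg 10 = L + j) ∧ (∀ a < L, s'.mem a = s.mem a) ∧ ∀ v < j, s'.mem (L + v) = 1)
      hn hs₁ ?_).mono (T := n * (1 + 4 + 1)) le_rfl (fun s' h => ⟨h.1.1, h.2⟩)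
    rintro j hj s' ⟨⟨hs', h7, h10⟩, hm, hl⟩
    refine Ensures.seq (Q := fun s'' => (Registers n z R O L i s'' ∧ s''.reg 7 = j ∧
      s''.reg 10 = L + j) ∧ (∀ a < L, s''.mem a = s.mem a) ∧ ∀ v < j + 1, s''.mem (L + v) = 1)
      ?_ ?_
    · refine ensures_block rfl (by simp) ⟨⟨⟨hs'.1, hs'.2, hs'.3, hs'.4, hs'.5, hs'.6, hs'.7⟩,
        h7, h10⟩, ?_, ?_⟩
      · intro a ha
        simp (disch := omega) [RAMInstr.apply, h10, hm a ha, Function.update_of_ne]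
      · intro v hv
        rcases (Nat.lt_succ_iff.1 hv).lt_or_eq with h | rfl
        · simp (disch := omega) [RAMInstr.apply, h10, hl v h, Function.update_of_ne]
        · simp [RAMInstr.apply, h10, hs'.r2]
    · rintro s₂ ⟨⟨hs₂, h7, h10⟩, hm, hl⟩
      refine (advance_ensures (by omega) (by omega) hj hs₂ h7 h10).mono le_rfl ?_
      rintro s₃ ⟨hs₃, hm', h7, h10, h8, -, -⟩
      exact ⟨⟨⟨hs₃, h7, h10⟩, by rwa [hm'], by rwa [hm']⟩, h8⟩

/-- The scan finds the vertex `u` that `τ` visits next: no label exceeds that of `u`, and the ones after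
`u` in the tie-breaking order are smaller. -/
theorem scan_ensures {G : SimpleGraph (Fin n)} {ρ τ : Fin n ≃ Fin n}
    (hτ : IsMCSPlusOrdering G ρ τ) (hn : 1 ≤ n) (hw : L + 2 * n + 2 < 2 ^ w) (hR : R + n ≤ L)
    (u : Fin n) {s : RAMStore} (hs : Registers n z R O L i s)
    (hρ : ∀ k : Fin n, s.mem (R + k) = ρ.symm k)
    (hlab : ∀ v : Fin n, s.mem (L + v) = searchLabel G τ (τ u) v) :
    scan.Ensures w (3 + n * 14) s fun s' => Registers n z R O L i s' ∧ s'.mem = s.mem ∧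
      s'.reg 12 = u := by
  refine Ensures.seq (Q := fun s' => (Registers n z R O L i s' ∧ s'.mem = s.mem ∧ s'.reg 7 = 0 ∧
      s'.reg 10 = R + 0) ∧ s'.reg 11 ≤ searchLabel G τ (τ u) u ∧
      ((ρ u : ℕ) < 0 → s'.reg 11 = searchLabel G τ (τ u) u ∧ s'.reg 12 = u)) ?_ ?_
  · refine ensures_block rfl (by simp) ?_
    obtain ⟨h0, h1, h2, h3, h4, h5, h6⟩ := hs
    refine ⟨⟨⟨?_, ?_, ?_, ?_, ?_, ?_, ?_⟩, ?_, ?_, ?_⟩, ?_, ?_⟩ <;>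
      simp (disch := omega) [RAMInstr.apply, h0, h1, h2, h3, h4, h5, h6, Nat.mod_eq_of_lt]
  · intro s₁ hs₁
    refine (ensures_loopWhileZero (fun j s' => (Registers n z R O L i s' ∧ s'.mem = s.mem ∧
      s'.reg 7 = j ∧ s'.reg 10 = R + j) ∧ s'.reg 11 ≤ searchLabel G τ (τ u) u ∧
      ((ρ u : ℕ) < j → s'.reg 11 = searchLabel G τ (τ u) u ∧ s'.reg 12 = u))
      hn hs₁ ?_).mono (T := n * (5 + (3 + 1 + 4) + 1)) le_rfl
      (fun s' h => ⟨h.1.1, h.1.2.1, (h.2.2 (ρ u).2).2⟩)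
    rintro j hj s' ⟨⟨⟨h0, h1, h2, h3, h4, h5, h6⟩, hm, h7, h10⟩, hle, hu⟩
    -- `v` is the vertex at position `j` of the tie-breaking order.
    obtain ⟨v, hρv, hmv⟩ : ∃ v : Fin n, (ρ v : ℕ) = j ∧ s.mem (R + j) = v :=
      ⟨ρ.symm ⟨j, hj⟩, by rw [Equiv.apply_symm_apply], hρ ⟨j, hj⟩⟩
    have hv2 := v.2
    obtain ⟨hmax, htie⟩ := hτ.searchLabel_le u v
    have hbound := searchLabel_le (G := G) τ (τ u) v
    have hlv := hlab v
    generalize searchLabel G τ (τ u) v = lv at *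
    have huv : u = v ↔ (ρ u : ℕ) = j := by
      rw [← hρv]
      exact ⟨fun h => by rw [h], fun h => ρ.injective (Fin.ext h)⟩
    refine Ensures.seq (Q := fun s'' => (Registers n z R O L i s'' ∧ s''.mem = s.mem ∧
      s''.reg 7 = j ∧ s''.reg 10 = R + j) ∧ s''.reg 11 = s'.reg 11 ∧ s''.reg 12 = s'.reg 12 ∧
      s''.reg 13 = v ∧ s''.reg 14 = lv ∧ s''.reg 15 = lv + 1 - s'.reg 11) ?_ ?_
    · refine ensures_block rfl (by simp) ?_
      refine ⟨⟨⟨?_, ?_, ?_, ?_, ?_, ?_, ?_⟩, ?_, ?_, ?_⟩, ?_, ?_, ?_, ?_, ?_⟩ <;>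
        simp (disch := omega) [RAMInstr.apply, h0, h1, h2, h3, h4, h5, h6, hm, h7, h10, hmv, hlv,
          Nat.mod_eq_of_lt]
    rintro s₂ ⟨⟨⟨h0, h1, h2, h3, h4, h5, h6⟩, hm, h7, h10⟩, h11, h12, h13, h14, h15⟩
    refine Ensures.seq (Q := fun s'' => (Registers n z R O L i s'' ∧ s''.mem = s.mem ∧
      s''.reg 7 = j ∧ s''.reg 10 = R + j) ∧ s''.reg 11 ≤ searchLabel G τ (τ u) u ∧
      ((ρ u : ℕ) < j + 1 → s''.reg 11 = searchLabel G τ (τ u) u ∧ s''.reg 12 = u)) ?_ ?_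
    · refine ensures_skipIfZero ?_ ?_
      · intro hz
        have hlt : lv < s'.reg 11 := by omega
        refine ⟨⟨⟨h0, h1, h2, h3, h4, h5, h6⟩, hm, h7, h10⟩, by rwa [h11], ?_⟩
        intro h
        rw [h11, h12]
        refine hu (lt_of_le_of_ne (Nat.lt_succ_iff.1 h) fun he => ?_)
        have := huv.2 he
        subst this
        rw [← hlab u, hlv] at hle
        omega
      · intro hz
        refine ensures_block rfl (by simp) ?_
        refine ⟨⟨⟨?_, ?_, ?_, ?_, ?_, ?_, ?_⟩, ?_, ?_, ?_⟩, ?_, ?_⟩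
        iterate 11
          simp (disch := omega) [RAMInstr.apply, h0, h1, h2, h3, h4, h5, h6, hm, h7, h10, h14,
            hmax, Nat.mod_eq_of_lt]
        intro h
        have hvu : u = v := by
          rw [huv]
          by_contra hne
          have hlt : (ρ u : ℕ) < j := by omega
          have h1 := (hu hlt).1
          have h2 : (ρ v : ℕ) ≤ ρ u := htie (by omega)
          omega
        subst hvu
        have : searchLabel G τ (τ u) u = lv := by rw [← hlab u, hlv]
        constructor <;> simp (disch := omega) [RAMInstr.apply, h13, h14, this, Nat.mod_eq_of_lt]
    · rintro s₃ ⟨⟨hs₃, hm, h7, h10⟩, hle', hu'⟩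
      refine (advance_ensures (by omega) (by omega) hj hs₃ h7 h10).mono le_rfl ?_
      rintro s₄ ⟨hs₄, hm', h7, h10, h8, h11, h12⟩
      exact ⟨⟨⟨hs₄, hm'.trans hm, h7, h10⟩, by rwa [h11], by rwa [h11, h12]⟩, h8⟩

theorem mul_add_lt_sq {a b : ℕ} (ha : a < n) (hb : b < n) : a * n + b < n * n := by
  have := Nat.mul_le_mul_right n (Nat.succ_le_of_lt ha)
  rw [Nat.succ_mul] at this
  omega

open Classical in
/-- Here `u` is the vertex that `τ` visits at time `i`, as found by `scan`. -/
theorem visit_ensures {G : SimpleGraph (Fin n)} {τ : Fin n ≃ Fin n} (hn : 1 ≤ n)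
    (hw : L + 2 * n + 2 < 2 ^ w) (hO : n * n ≤ O) (hOL : O + n ≤ L) (u : Fin n)
    (hi : (τ u : ℕ) = i) {s : RAMStore} (hs : Registers n z R O L i s) (h12 : s.reg 12 = u)
    (hadj : ∀ v : Fin n, s.mem (v * n + u) = if G.Adj v u then 1 else 0)
    (hlab : ∀ v : Fin n, s.mem (L + v) = searchLabel G τ i v) :
    visit.Ensures w (8 + n * 12) s fun s' => Registers n z R O L i s' ∧
      (∀ a < L, a ≠ O + i → s'.mem a = s.mem a) ∧ s'.mem (O + i) = u ∧
      ∀ v : Fin n, s'.mem (L + v) = searchLabel G τ (i + 1) v := by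
  have hu := u.2
  have hin : i < n := hi ▸ (τ u).2
  set g : Fin n → ℕ := fun v => if v = u then 0 else searchLabel G τ i v with hg
  have hgle : ∀ v, g v ≤ n + 1 := by
    intro v
    have := searchLabel_le (G := G) τ i v
    by_cases hv : v = u <;> simp [hg, hv, this]
  refine Ensures.seq (Q := fun s' => (Registers n z R O L i s' ∧ s'.reg 7 = 0 ∧
      s'.reg 10 = L + 0 ∧ s'.reg 11 = u + 0 * n) ∧ (∀ a < L, a ≠ O + i → s'.mem a = s.mem a) ∧
      s'.mem (O + i) = u ∧ ∀ v : Fin n, s'.mem (L + v) =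
        if (v : ℕ) < 0 then searchLabel G τ (i + 1) v else g v) ?_ ?_
  · refine ensures_block rfl (by simp) ?_
    obtain ⟨h0, h1, h2, h3, h4, h5, h6⟩ := hs
    refine ⟨⟨⟨?_, ?_, ?_, ?_, ?_, ?_, ?_⟩, ?_, ?_, ?_⟩, ?_, ?_, ?_⟩
    iterate 10
      simp (disch := omega) [RAMInstr.apply, h0, h1, h2, h3, h4, h5, h6, h12, Nat.mod_eq_of_lt]
    · intro a ha hai
      simp (disch := omega) [RAMInstr.apply, h4, h5, h6, h12, Nat.mod_eq_of_lt,
        Function.update_of_ne]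
    · simp (disch := omega) [RAMInstr.apply, h4, h5, h6, h12, Nat.mod_eq_of_lt,
        Function.update_of_ne]
    · intro v
      by_cases hv : v = u
      · subst hv
        simp (disch := omega) [RAMInstr.apply, h4, h5, h6, h12, Nat.mod_eq_of_lt, hg]
      · have hv' : (v : ℕ) ≠ u := fun h => hv (Fin.ext h)
        simp (disch := omega) [RAMInstr.apply, h4, h5, h6, h12, Nat.mod_eq_of_lt, hg, hv,
          Function.update_of_ne, hlab]
  · intro s₁ hs₁
    refine (ensures_loopWhileZero (fun j s' => (Registers n z R O L i s' ∧ s'.reg 7 = j ∧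
      s'.reg 10 = L + j ∧ s'.reg 11 = u + j * n) ∧ (∀ a < L, a ≠ O + i → s'.mem a = s.mem a) ∧
      s'.mem (O + i) = u ∧ ∀ v : Fin n, s'.mem (L + v) =
        if (v : ℕ) < j then searchLabel G τ (i + 1) v else g v)
      hn hs₁ ?_).mono (T := n * (7 + 4 + 1)) le_rfl
      (fun s' h => ⟨h.1.1, h.2.1, h.2.2.1, fun v => by rw [h.2.2.2 v, if_pos v.2]⟩)
    rintro j hj s' ⟨⟨hs', h7, h10, h11⟩, hm, hmO, hl⟩
    refine Ensures.seq (Q := fun s' => (Registers n z R O L i s' ∧ s'.reg 7 = j ∧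
      s'.reg 10 = L + j ∧ s'.reg 11 = u + (j + 1) * n) ∧
      (∀ a < L, a ≠ O + i → s'.mem a = s.mem a) ∧ s'.mem (O + i) = u ∧
      ∀ v : Fin n, s'.mem (L + v) =
        if (v : ℕ) < j + 1 then searchLabel G τ (i + 1) v else g v) ?_ ?_
    · obtain ⟨h0, h1, h2, h3, h4, h5, h6⟩ := hs'
      have hsq : j * n + u < n * n := mul_add_lt_sq hj hu
      obtain ⟨a, ha⟩ : ∃ a, a = if G.Adj ⟨j, hj⟩ u then 1 else 0 := ⟨_, rfl⟩
      have ha1 : a ≤ 1 := by rw [ha]; split_ifs <;> omega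
      have hma : s'.mem (u + j * n) = a := by
        rw [Nat.add_comm, hm _ (by omega) (by omega), hadj ⟨j, hj⟩, ha]
      obtain ⟨c, hc⟩ : ∃ c, c = g ⟨j, hj⟩ := ⟨_, rfl⟩
      have hcn : c ≤ n + 1 := hc ▸ hgle _
      have hmc : s'.mem (L + j) = c := by
        rw [hl ⟨j, hj⟩, if_neg (lt_irrefl _), hc]
      have hnew : searchLabel G τ (i + 1) ⟨j, hj⟩ = c + (a - (a - c)) := by
        rw [← hi]
        refine searchLabel_succ τ u _ c a ?_ ha
        rw [hc, hi]
      have hle : c + (a - (a - c)) ≤ n + 2 := by omega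
      have hjn : (j + 1) * n = j * n + n := Nat.succ_mul j n
      have hsq' : (j : ℕ) * n + u + n < 2 ^ w := by omega
      clear_value g
      generalize j * n = J at *
      generalize n * n = N at *
      clear hgle hc ha
      refine ensures_block rfl (by simp) ?_
      refine ⟨⟨⟨?_, ?_, ?_, ?_, ?_, ?_, ?_⟩, ?_, ?_, ?_⟩, ?_, ?_, ?_⟩
      iterate 9
        simp [RAMInstr.apply, h0, h1, h2, h3, h4, h5, h6, h7, h10]
      · simp (disch := omega) [RAMInstr.apply, h0, h11, hjn, Nat.mod_eq_of_lt, Nat.add_assoc]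
      · intro b hb hbi
        simp (disch := omega) [RAMInstr.apply, h10, Function.update_of_ne, hm b hb hbi]
      · simp (disch := omega) [RAMInstr.apply, h10, Function.update_of_ne, hmO]
      · intro v
        rcases lt_trichotomy (v : ℕ) j with hv | hv | hv
        · have hv' : (v : ℕ) < j + 1 := by omega
          simp (disch := omega) [RAMInstr.apply, h10, Function.update_of_ne, hl v, hv, hv']
        · obtain rfl : v = ⟨j, hj⟩ := Fin.ext hv
          simp (disch := omega) [RAMInstr.apply, h10, h11, hma, hmc, hnew, Nat.mod_eq_of_lt]
        · have hv1 : ¬ (v : ℕ) < j := by omega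
          have hv2 : ¬ (v : ℕ) < j + 1 := by omega
          simp (disch := omega) [RAMInstr.apply, h10, Function.update_of_ne, hl v, hv1, hv2]
    · rintro s₂ ⟨⟨hs₂, h7, h10, h11⟩, hm, hmO, hl⟩
      refine (advance_ensures (by omega) (by omega) hj hs₂ h7 h10).mono le_rfl ?_
      rintro s₃ ⟨hs₃, hm', h7, h10, h8, h11', -⟩
      exact ⟨⟨⟨hs₃, h7, h10, h11'.trans h11⟩, by rwa [hm'], by rwa [hm'], by rwa [hm']⟩, h8⟩

open Classical in
/-- The search writes the ordering with ties broken by `ρ` to the addresses from `O` on, and changes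
nothing else below the labels. -/
theorem search_ensures {G : SimpleGraph (Fin n)} {ρ τ : Fin n ≃ Fin n}
    (hτ : IsMCSPlusOrdering G ρ τ) (hn : 1 ≤ n) (hw : L + 2 * n + 2 < 2 ^ w) (hO : n * n ≤ O)
    (hOL : O + n ≤ L) (hR : n * n ≤ R) (hRL : R + n ≤ L) (hRO : R + n ≤ O ∨ O + n ≤ R)
    {s : RAMStore} (hs : Registers n z R O L i s)
    (hadj : ∀ v u : Fin n, s.mem (v * n + u) = if G.Adj v u then 1 else 0)
    (hρ : ∀ k : Fin n, s.mem (R + k) = ρ.symm k) :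
    search.Ensures w (3 + n * (21 + n * 26)) s fun s' => Registers n z R O L n s' ∧
      (∀ a < L, a < O ∨ O + n ≤ a → s'.mem a = s.mem a) ∧
      ∀ k : Fin n, s'.mem (O + k) = τ.symm k := by
  refine (Ensures.seq (resetLabels_ensures hn hw hs) (T' := 1 + n * ((3 + n * 14) +
    ((8 + n * 12) + 3) + 1)) (Q' := fun s' => Registers n z R O L n s' ∧
      (∀ a < L, a < O ∨ O + n ≤ a → s'.mem a = s.mem a) ∧
      ∀ k : Fin n, s'.mem (O + k) = τ.symm k) ?_).mono ?_ (fun _ h => h)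
  · rintro s₁ ⟨hs₁, hm₁, hl₁⟩
    refine Ensures.seq (Q := fun s' => Registers n z R O L 0 s' ∧
      (∀ a < L, a < O ∨ O + n ≤ a → s'.mem a = s.mem a) ∧
      (∀ k : Fin n, (k : ℕ) < 0 → s'.mem (O + k) = τ.symm k) ∧
      ∀ v : Fin n, s'.mem (L + v) = searchLabel G τ 0 v) ?_ ?_
    · obtain ⟨h0, h1, h2, h3, h4, h5, h6⟩ := hs₁
      refine ensures_block rfl (by simp) ⟨⟨?_, ?_, ?_, ?_, ?_, ?_, ?_⟩, ?_, ?_, ?_⟩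
      iterate 7 simp [RAMInstr.apply, h0, h1, h2, h3, h4, h5]
      · exact fun a ha _ => hm₁ a ha
      · exact fun k hk => absurd hk (Nat.not_lt_zero _)
      · intro v
        rw [searchLabel_zero]
        exact hl₁ v v.2
    intro s₂ hs₂
    refine (ensures_loopWhileZero (fun i s' => Registers n z R O L i s' ∧
      (∀ a < L, a < O ∨ O + n ≤ a → s'.mem a = s.mem a) ∧
      (∀ k : Fin n, (k : ℕ) < i → s'.mem (O + k) = τ.symm k) ∧
      ∀ v : Fin n, s'.mem (L + v) = searchLabel G τ i v) hn hs₂ ?_).mono le_rfl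
      (fun s' h => ⟨h.1, h.2.1, fun k => h.2.2.1 k k.2⟩)
    rintro i hi s' ⟨hs', hm, ho, hl⟩
    obtain ⟨u, hu⟩ : ∃ u, u = τ.symm ⟨i, hi⟩ := ⟨_, rfl⟩
    have hτu : (τ u : ℕ) = i := by rw [hu, Equiv.apply_symm_apply]
    refine Ensures.seq (scan_ensures hτ hn hw hRL u hs' ?_ ?_) ?_
    · intro k
      rw [← hρ k]
      have := k.2
      exact hm _ (by omega) (by omega)
    · intro v
      rw [hτu]
      exact hl v
    rintro s₃ ⟨hs₃, hm₃, h12⟩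
    refine Ensures.seq (visit_ensures (G := G) hn hw hO hOL u hτu hs₃ h12 ?_ ?_) ?_
    · intro v
      rw [hm₃, ← hadj v u]
      have := mul_add_lt_sq v.2 u.2
      exact hm _ (by omega) (Or.inl (by omega))
    · intro v
      rw [hm₃]
      exact hl v
    rintro s₄ ⟨⟨h0, h1, h2, h3, h4, h5, h6⟩, hm₄, ho₄, hl₄⟩
    refine ensures_block rfl (by simp) ⟨⟨⟨?_, ?_, ?_, ?_, ?_, ?_, ?_⟩, ?_, ?_, ?_⟩, ?_⟩
    iterate 7 simp (disch := omega) [RAMInstr.apply, h0, h1, h2, h3, h4, h5, h6, Nat.mod_eq_of_lt]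
    · intro a ha hao
      rw [← hm a ha hao, ← hm₃]
      exact hm₄ a ha (by omega)
    · intro k hk
      rcases (Nat.lt_succ_iff.1 hk).lt_or_eq with h | h
      · rw [← ho k h, ← hm₃]
        exact hm₄ _ (by omega) (by omega)
      · obtain rfl : k = ⟨i, hi⟩ := Fin.ext h
        rw [← hu]
        exact ho₄
    · exact hl₄
    · simp (disch := omega) [RAMInstr.apply, h0, h2, h6, Nat.mod_eq_of_lt]
      omega
  · have h1 : 3 + n * 14 + (8 + n * 12 + 3) + 1 = 15 + n * 26 := by omega
    have h2 : n * (21 + n * 26) = n * 6 + n * (15 + n * 26) := by ring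
    rw [h1, h2]
    omega

end MCSProgram

/-! ### The decision program -/

namespace MCSProgram

open RAMInstr RAMCode

variable {n w z : ℕ}

/-- Compute `n ^ 2` in register `9`. -/
def square : RAMCode :=
  (block [const 2 1, sub 7 7 7, sub 9 9 9]).seq
    (loopWhileZero (block [add 9 9 0, add 7 7 2, add 8 7 2, sub 8 8 0]) 8)

/-- Set up the addresses, and write at `n ^ 2 + n` the order `0, …, n - 1` with `z` and `n - 1`
exchanged, so that the first search starts with `z`. -/
def initialOrder : RAMCode :=
  (block [add 3 9 0, add 5 3 0, sub 4 3 0, sub 6 6 6, sub 7 7 7, add 10 3 7]).seq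
    ((loopWhileZero ((block [store 10 7]).seq advance) 8).seq
      (block [sub 11 0 2, add 10 3 1, store 10 11, add 10 3 11, store 10 1]))

/-- Put `1` into register `0` if the last vertex of the order after the address in register `4`
is `z`, and `0` otherwise. -/
def answer : RAMCode :=
  block [add 10 4 0, sub 10 10 2, load 10 10, sub 11 10 1, sub 12 1 10, add 11 11 12, sub 0 2 11]

/-- The first search writes `σ` to `n ^ 2`, with ties broken by the order at `n ^ 2 + n`; the second
one writes `τ` to `n ^ 2 + n`, with ties broken by `σ`. -/
def decision : RAMCode :=
  square.seq (initialOrder.seq (search.seq ((block [sub 3 3 0, add 4 4 0]).seq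
    (search.seq answer))))

theorem square_ensures (hn : 1 ≤ n) (hw : n * n + 4 * n + 2 < 2 ^ w) {s : RAMStore}
    (h0 : s.reg 0 = n) (h1 : s.reg 1 = z) :
    square.Ensures w (3 + n * 5) s fun s' => s'.reg 0 = n ∧ s'.reg 1 = z ∧ s'.reg 2 = 1 ∧
      s'.reg 9 = n * n ∧ s'.mem = s.mem := by
  refine Ensures.seq (Q := fun s' => s'.reg 0 = n ∧ s'.reg 1 = z ∧ s'.reg 2 = 1 ∧
    s'.reg 9 = 0 * n ∧ s'.reg 7 = 0 ∧ s'.mem = s.mem) ?_ ?_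
  · refine ensures_block rfl (by simp) ?_
    refine ⟨?_, ?_, ?_, ?_, ?_, ?_⟩ <;>
      simp (disch := omega) [RAMInstr.apply, h0, h1, Nat.mod_eq_of_lt]
  · intro s₁ hs₁
    refine (ensures_loopWhileZero (fun j s' => s'.reg 0 = n ∧ s'.reg 1 = z ∧ s'.reg 2 = 1 ∧
      s'.reg 9 = j * n ∧ s'.reg 7 = j ∧ s'.mem = s.mem) hn hs₁ ?_).mono (T := n * (4 + 1)) le_rfl
      (fun s' h => ⟨h.1, h.2.1, h.2.2.1, h.2.2.2.1, h.2.2.2.2.2⟩)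
    rintro j hj s' ⟨h0, h1, h2, h9, h7, hm⟩
    have hjn : (j + 1) * n = j * n + n := Nat.succ_mul j n
    have hle : (j + 1) * n ≤ n * n := Nat.mul_le_mul_right n hj
    rw [hjn] at hle ⊢
    generalize j * n = J at *
    generalize n * n = N at *
    refine ensures_block rfl (by simp) ⟨⟨?_, ?_, ?_, ?_, ?_, ?_⟩, ?_⟩
    iterate 6 simp (disch := omega) [RAMInstr.apply, h0, h1, h2, h9, h7, hm, Nat.mod_eq_of_lt]
    · simp (disch := omega) [RAMInstr.apply, h0, h2, h7, Nat.mod_eq_of_lt]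
      omega

theorem initialOrder_ensures (hw : n * n + 4 * n + 2 < 2 ^ w) (z l : Fin n)
    (hl : (l : ℕ) + 1 = n) {s : RAMStore} (h0 : s.reg 0 = n) (h1 : s.reg 1 = z)
    (h2 : s.reg 2 = 1) (h9 : s.reg 9 = n * n) :
    initialOrder.Ensures w (11 + n * 6) s fun s' =>
      Registers n z (n * n + n) (n * n) (n * n + 2 * n) 0 s' ∧
      (∀ a < n * n, s'.mem a = s.mem a) ∧
      ∀ k : Fin n, s'.mem (n * n + n + k) = (Equiv.swap z l).symm k := by
  have hz := z.2
  generalize n * n = N at *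
  refine (Ensures.seq (T := 6) (T' := n * (1 + 4 + 1) + 5) (Q := fun s' =>
    (Registers n z (N + n) N (N + 2 * n) 0 s' ∧ s'.reg 7 = 0 ∧ s'.reg 10 = N + n + 0) ∧
    (∀ a < N, s'.mem a = s.mem a) ∧ ∀ k < 0, s'.mem (N + n + k) = k) ?_ ?_).mono (by omega)
    (fun _ h => h)
  · refine ensures_block rfl (by simp) ?_
    refine ⟨⟨⟨?_, ?_, ?_, ?_, ?_, ?_, ?_⟩, ?_, ?_⟩, ?_, ?_⟩ <;>
      simp (disch := omega) [RAMInstr.apply, h0, h1, h2, h9, Nat.mod_eq_of_lt]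
    omega
  · intro s₁ hs₁
    refine Ensures.seq (ensures_loopWhileZero (fun j s' => (Registers n z (N + n) N (N + 2 * n) 0 s' ∧
      s'.reg 7 = j ∧ s'.reg 10 = N + n + j) ∧
      (∀ a < N, s'.mem a = s.mem a) ∧ ∀ k < j, s'.mem (N + n + k) = k) (by omega) hs₁ ?_) ?_
    · rintro j hj s₂ ⟨⟨hs₂, h7, h10⟩, hm, hl⟩
      refine Ensures.seq (Q := fun s' => (Registers n z (N + n) N (N + 2 * n) 0 s' ∧
        s'.reg 7 = j ∧ s'.reg 10 = N + n + j) ∧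
        (∀ a < N, s'.mem a = s.mem a) ∧ ∀ k < j + 1, s'.mem (N + n + k) = k) ?_ ?_
      · refine ensures_block rfl (by simp) ⟨⟨⟨hs₂.1, hs₂.2, hs₂.3, hs₂.4, hs₂.5, hs₂.6, hs₂.7⟩,
          h7, h10⟩, ?_, ?_⟩
        · intro a ha
          simp (disch := omega) [RAMInstr.apply, h10, hm a ha, Function.update_of_ne]
        · intro v hv
          rcases (Nat.lt_succ_iff.1 hv).lt_or_eq with h | rfl
          · simp (disch := omega) [RAMInstr.apply, h10, hl v h, Function.update_of_ne]
          · simp [RAMInstr.apply, h10, h7]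
      · rintro s₃ ⟨⟨hs₃, h7, h10⟩, hm, hl⟩
        refine (advance_ensures (by omega) (by omega) hj hs₃ h7 h10).mono le_rfl ?_
        rintro s₄ ⟨hs₄, hm', h7, h10, h8, -, -⟩
        exact ⟨⟨⟨hs₄, h7, h10⟩, by rwa [hm'], by rwa [hm']⟩, h8⟩
    · rintro s₂ ⟨⟨⟨h0, h1, h2, h3, h4, h5, h6⟩, -, -⟩, hm, hk⟩
      refine ensures_block rfl (by simp) ⟨⟨?_, ?_, ?_, ?_, ?_, ?_, ?_⟩, ?_, ?_⟩
      iterate 7 simp [RAMInstr.apply, h0, h1, h2, h3, h4, h5, h6]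
      · intro a ha
        simp (disch := omega) [RAMInstr.apply, h0, h1, h2, h3, hm a ha, Nat.mod_eq_of_lt,
          Function.update_of_ne]
      · intro k
        have hk2 := k.2
        have hln : n - 1 = l := by omega
        rw [Equiv.symm_swap, Equiv.swap_apply_def]
        by_cases hkl : k = l
        · subst hkl
          have : (if k = z then k else if k = k then z else k) = z := by
            rw [if_pos rfl]
            split_ifs with h
            exacts [h, rfl]
          rw [this]
          simp (disch := omega) [RAMInstr.apply, h0, h1, h2, h3, hln, Nat.mod_eq_of_lt]
        · have hkl' : (k : ℕ) ≠ l := fun h => hkl (Fin.ext h)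
          by_cases hkz : k = z
          · subst hkz
            simp (disch := omega) [RAMInstr.apply, h0, h1, h2, h3, hln, Nat.mod_eq_of_lt,
              Function.update_of_ne]
          · have hkz' : (k : ℕ) ≠ z := fun h => hkz (Fin.ext h)
            simp (disch := omega) [RAMInstr.apply, h0, h1, h2, h3, hln, Nat.mod_eq_of_lt,
              Function.update_of_ne, hk k hk2, hkl, hkz]

theorem answer_ensures {R O L i : ℕ} (hw : O + 2 * n + 2 < 2 ^ w) {z x : Fin n} {s : RAMStore}
    (hs : Registers n z R O L i s) (hx : s.mem (O + (n - 1)) = x) :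
    answer.Ensures w 7 s fun s' => s'.reg 0 = (if x = z then 1 else 0) ∧ s'.mem = s.mem := by
  have hz := z.2
  have hx2 := x.2
  have hO : O + n - 1 = O + (n - 1) := by omega
  refine ensures_block rfl (by simp) ⟨?_, ?_⟩
  · obtain ⟨h0, h1, h2, h3, h4, h5, h6⟩ := hs
    simp (disch := omega) [RAMInstr.apply, h0, h1, h2, h4, hO, hx, Nat.mod_eq_of_lt]
    split_ifs with h
    · rw [h]
      omega
    · have : (x : ℕ) ≠ z := fun h' => h (Fin.ext h')
      omega
  · simp [RAMInstr.apply]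

open Classical in
theorem graphInput_mem (G : SimpleGraph (Fin n)) (z v u : Fin n) :
    (graphInput G z).mem (v * n + u) = if G.Adj v u then 1 else 0 := by
  have h : (∃ i j : Fin n, G.Adj i j ∧ (v * n + u : ℕ) = i * n + j) ↔ G.Adj v u := by
    constructor
    · rintro ⟨i, j, hij, h⟩
      have hn : 0 < n := v.pos
      have h1 : ∀ a b : Fin n, ((a * n + b : ℕ) / n = a ∧ (a * n + b : ℕ) % n = b) := by
        intro a b
        constructor
        · rw [Nat.mul_comm, Nat.mul_add_div hn, Nat.div_eq_of_lt b.2, Nat.add_zero]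
        · rw [Nat.mul_comm, Nat.mul_add_mod, Nat.mod_eq_of_lt b.2]
      have h2 : v = i := Fin.ext (by rw [← (h1 v u).1, h, (h1 i j).1])
      have h3 : u = j := Fin.ext (by rw [← (h1 v u).2, h, (h1 i j).2])
      rwa [h2, h3]
    · exact fun h => ⟨v, u, h, rfl⟩
  simp only [graphInput, h]

theorem decision_ensures (G : SimpleGraph (Fin n)) (z : Fin n)
    (hw : n * n + 4 * n + 2 < 2 ^ w) :
    ∃ σ τ : Fin n ≃ Fin n, IsMCSOrdering G σ ∧ IsStartVertex σ z ∧ IsMCSPlusOrdering G σ τ ∧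
      decision.Ensures w (200 * n ^ 2) ⟨(graphInput G z).reg, (graphInput G z).mem⟩ fun s' =>
        (s'.reg 0 = 0 ∨ s'.reg 0 = 1) ∧ (s'.reg 0 = 1 ↔ IsEndVertex τ z) ∧
        (∀ k : Fin n, s'.mem (n * n + k) = σ.symm k) ∧
        ∀ k : Fin n, s'.mem (n * n + n + k) = τ.symm k := by
  classical
  have hn : 1 ≤ n := z.pos
  obtain ⟨l, hl⟩ : ∃ l : Fin n, (l : ℕ) + 1 = n := ⟨⟨n - 1, by omega⟩, by simp only; omega⟩
  obtain ⟨σ, hσ⟩ := exists_isMCSPlusOrdering G (Equiv.swap z l)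
  obtain ⟨τ, hτ⟩ := exists_isMCSPlusOrdering G σ
  have hsq : n ≤ n * n := Nat.le_mul_of_pos_left n hn
  refine ⟨σ, τ, hσ.1, hσ.isStartVertex ?_, hτ, ?_⟩
  · rw [IsEndVertex, Equiv.swap_apply_left]
    exact hl
  have hadj := graphInput_mem G z
  have hlt : ∀ v u : Fin n, (v * n + u : ℕ) < n * n := fun v u => mul_add_lt_sq v.2 u.2
  refine (Ensures.seq (square_ensures (z := z) hn hw (by simp [graphInput])
    (by simp [graphInput])) (T' := 11 + n * 6 + (3 + n * (21 + n * 26) + (2 +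
      (3 + n * (21 + n * 26) + 7)))) ?_).mono ?_ (fun _ h => h)
  · rintro s₁ ⟨h0, h1, h2, h9, hm₁⟩
    refine Ensures.seq (initialOrder_ensures hw z l hl h0 h1 h2 h9) ?_
    rintro s₂ ⟨hs₂, hm₂, hρ⟩
    have hadj₂ : ∀ v u : Fin n, s₂.mem (v * n + u) = if G.Adj v u then 1 else 0 := by
      intro v u
      rw [← hadj v u, hm₂ _ (hlt v u), hm₁]
    generalize hN : n * n = N at *
    refine Ensures.seq (search_ensures hσ hn (by omega) hN.le (by omega) (by omega) (by omega)
      (by omega) hs₂ hadj₂ hρ) ?_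
    rintro s₃ ⟨⟨h0, h1, h2, h3, h4, h5, h6⟩, hm₃, hσm⟩
    refine Ensures.seq (Q := fun s' => Registers n z N (N + n) (N + 2 * n) n s' ∧
      s'.mem = s₃.mem) ?_ ?_
    · refine ensures_block rfl (by simp) ⟨⟨?_, ?_, ?_, ?_, ?_, ?_, ?_⟩, ?_⟩ <;>
        simp (disch := omega) [RAMInstr.apply, h0, h1, h2, h3, h4, h5, h6, Nat.mod_eq_of_lt]
    rintro s₄ ⟨hs₄, hm₄⟩
    refine Ensures.seq (search_ensures (G := G) hτ hn (by omega) (by omega) (by omega) hN.le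
      (by omega) (by omega) hs₄ ?_ ?_) ?_
    · intro v u
      have := hlt v u
      rw [hm₄, hm₃ _ (by omega) (by omega), hadj₂]
    · intro k
      rw [hm₄, hσm]
    rintro s₅ ⟨hs₅, hm₅, hτm⟩
    have hlast : s₅.mem (N + n + (n - 1)) = τ.symm l := by
      rw [← hτm l]
      congr 1
      omega
    refine (answer_ensures (by omega) hs₅ hlast).mono le_rfl ?_
    rintro s₆ ⟨ha, hm₆⟩
    have hend : τ.symm l = z ↔ IsEndVertex τ z := by
      rw [IsEndVertex, Equiv.symm_apply_eq, Fin.ext_iff]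
      omega
    rw [hm₆]
    refine ⟨?_, ?_, ?_, hτm⟩
    · rw [ha]
      split_ifs <;> simp
    · rw [ha, ← hend]
      split_ifs with h <;> simp [h]
    · intro k
      have := k.2
      rw [hm₅ _ (by omega) (by omega), hm₄, hσm]
  · have h1 : n * (21 + n * 26) = 21 * n + 26 * (n * n) := by ring
    rw [h1, Nat.pow_two]
    omega

end MCSProgram

theorem theorem1 :
    (∃ (P : RAMProgram) (C K : ℕ), ∀ (n : ℕ) (G : SimpleGraph (Fin n)) (z : Fin n),
      IsChordal G → ∀ w : ℕ, K * (n + 1) ^ 2 ≤ 2 ^ w →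
        P.HaltsWithin w (C * n ^ 2) (graphInput G z) fun s =>
          (s.reg 0 = 0 ∨ s.reg 0 = 1) ∧ (s.reg 0 = 1 ↔ IsMCSEndVertex G z) ∧
          ∃ σ τ : Fin n ≃ Fin n,
            IsMCSOrdering G σ ∧ IsStartVertex σ z ∧ IsMCSPlusOrdering G σ τ ∧
            StoredAt s (n ^ 2) σ ∧ StoredAt s (n ^ 2 + n) τ ∧
            (s.reg 0 = 1 ↔ IsEndVertex τ z)) ∧
    (∀ {V : Type*} {n : ℕ} (G : SimpleGraph V) (z : V) (σ τ : V ≃ Fin n),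
      IsChordal G → IsMCSOrdering G σ → IsStartVertex σ z → IsMCSPlusOrdering G σ τ →
        (IsMCSEndVertex G z ↔ IsEndVertex τ z)) := by
  refine ⟨⟨MCSProgram.decision.compile 0, 200, 3, fun n G z hG w hw => ?_⟩,
    fun G z σ τ hG hσ hz hτ => isMCSEndVertex_iff_isEndVertex hG hσ hz hτ⟩
  have hw' : n * n + 4 * n + 2 < 2 ^ w := by
    have : 3 * (n + 1) ^ 2 = 3 * (n * n) + 6 * n + 3 := by ring
    omega
  obtain ⟨σ, τ, hσ, hz, hτ, hprog⟩ := MCSProgram.decision_ensures G z hw'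
  obtain ⟨t, ht, hhalt, h01, hend, hσm, hτm⟩ := hprog.haltsWithin
  refine ⟨t, ht, hhalt, h01, ?_, σ, τ, hσ, hz, hτ, ?_, ?_, hend⟩
  · rw [isMCSEndVertex_iff_isEndVertex hG hσ hz hτ]
    exact hend
  · rwa [StoredAt, Nat.pow_two]
  · rwa [StoredAt, Nat.pow_two]
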